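/- **Theorem 4.** An instance of *Maximum Vertex-Disjoint Shortest Paths* on weighted directed graphs consists of a directed graph $G=(V,E)$ with $n$ vertices, an arc-length function $w\colon E\to\mathbb{Q}_{\ge 0}$, terminal pairs $(s_1,t_1),\dots,(s_k,t_k)$ of vertices with $s_i\ne t_i$ for each $i$, and an integer $p\ge 0$. A path is a sequence of distinct vertices in which consecutive vertices are joined by an arc, and its length is the sum of its arc lengths. A *solution* is a set $S\subseteq\{1,\dots,k\}$ with $|S|\ge p$ together with pairwise vertex-disjoint paths $(P_i)_{i\in S}$ (disjoint including their ends) such that each $P_i$ is a shortest path from $s_i$ to $t_i$ in $G$. The question is whether a solution exists. Let $\ell$ be the minimum total number of arcs of the paths in a solution if a solution exists, and $\ell=n$ otherwise. There is a deterministic algorithm that decides every instance correctly in $2^{O(\ell)}\cdot\mathrm{poly}(n)$ time; it is not given $\ell$. Here time is the number of steps of a random access machine on which additions (and, for indices and counters, subtractions) and comparisons of natural numbers and of arc lengths take one step each and which has no multiplication, and the terminal pairs are assumed to be pairwise distinct (so that $k\le n^2$). If terminal pairs may be repeated, the same algorithm takes $2^{O(\ell)}\cdot\mathrm{poly}(n+k)$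 time. -/

import Mathlib

open scoped NNRat

/-! ### The problem -/

/-- An instance of Maximum Vertex-Disjoint Shortest Paths on a weighted directed graph with
vertex set `{0, …, n - 1}`. The values of `w` outside the arc set are irrelevant: no notion below
looks at them, and they are not part of the input that an algorithm gets. -/
structure MVDSP where
  /-- number of vertices -/
  n : ℕ
  /-- the directed graph -/
  G : Digraph (Fin n)
  /-- arc lengths -/
  w : Fin n → Fin n → ℚ≥0
  /-- number of terminal pairs -/
  k : ℕ
  /-- the terminals `s i` -/
  s : Fin k → Fin n
  /-- the terminals `t i` -/
  t : Fin k → Fin n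
  s_ne_t : ∀ i, s i ≠ t i
  /-- how many pairs have to be connected -/
  p : ℕ

namespace MVDSP

variable (I : MVDSP)

/-- `P` is a path from `a` to `b`: a sequence of distinct vertices, consecutive ones joined by an
arc, with first vertex `a` and last vertex `b`. -/
def IsPath (a b : Fin I.n) (P : List (Fin I.n)) : Prop :=
  P.head? = some a ∧ P.getLast? = some b ∧ P.IsChain I.G.Adj ∧ P.Nodup

/-- The length of a path: the sum of the lengths of its arcs. -/
def pathLength (P : List (Fin I.n)) : ℚ≥0 :=
  (List.zipWith I.w P P.tail).sum

/-- `P` is a shortest path from `a` to `b`. -/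
def IsShortestPath (a b : Fin I.n) (P : List (Fin I.n)) : Prop :=
  I.IsPath a b P ∧ ∀ Q, I.IsPath a b Q → I.pathLength P ≤ I.pathLength Q

/-- `(P i)` for `i ∈ S` is a solution: at least `p` pairwise (completely) vertex-disjoint paths,
the `i`-th one a shortest path from `s i` to `t i`. The lists `P i` with `i ∉ S` play no role. -/
def IsSolution (S : Finset (Fin I.k)) (P : Fin I.k → List (Fin I.n)) : Prop :=
  I.p ≤ S.card ∧
  (∀ i ∈ S, I.IsShortestPath (I.s i) (I.t i) (P i)) ∧
  (∀ i ∈ S, ∀ j ∈ S, i ≠ j → (P i).Disjoint (P j))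

/-- The instance is a yes-instance. -/
def IsYes : Prop := ∃ S P, I.IsSolution S P

/-- The number of arcs in the paths `P i`, `i ∈ S`. -/
def numArcs (S : Finset (Fin I.k)) (P : Fin I.k → List (Fin I.n)) : ℕ :=
  ∑ i ∈ S, ((P i).length - 1)

open Classical in
/-- The parameter `ℓ`: the minimum number of arcs in a solution if there is one, and the number of
vertices otherwise. -/
noncomputable def ell : ℕ :=
  if I.IsYes then sInf {m | ∃ S P, I.IsSolution S P ∧ I.numArcs S P = m} else I.n

end MVDSP

/-! ### The machine model

Deterministic random access machines in the comparison-addition model, programmed by structured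
programs. A machine has word variables and arrays of words (words are natural numbers, and serve
as array indices), and number variables and arrays of numbers (nonnegative rationals: the arc
lengths). A program is a fixed finite text; it names finitely many variables and arrays. Words can
be added, subtracted (truncated at `0`) and compared; numbers can only be added and compared. Every
elementary operation costs one unit. There is no multiplication, so after `T` steps all entries
have bit length at most `O(T)` plus the total bit length of the input (all denominators divide the
product of the input denominators), and the model is polynomially related to Turing machines. -/

namespace RAM

/-- The memory. -/
structure State where
  /-- word variables -/
  var : ℕ → ℕ
  /-- `arr a i` is the `i`-th entry of the word array `a` -/
  arr : ℕ → ℕ → ℕ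
  /-- number variables -/
  qvar : ℕ → ℚ≥0
  /-- `qarr a i` is the `i`-th entry of the number array `a` -/
  qarr : ℕ → ℕ → ℚ≥0

/-- Word expressions. -/
inductive NExp where
  | lit (m : ℕ)
  | var (x : ℕ)
  | get (a : ℕ) (i : NExp)
  | add (e f : NExp)
  | sub (e f : NExp)

/-- Number expressions. -/
inductive QExp where
  | zero
  | var (x : ℕ)
  | get (a : ℕ) (i : NExp)
  | add (e f : QExp)

/-- Tests. -/
inductive BExp where
  | le (e f : NExp)
  | qle (e f : QExp)
  | not (b : BExp)
  | and (b d : BExp)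

/-- The value of a word expression. -/
def NExp.eval (σ : State) : NExp → ℕ
  | lit m => m
  | var x => σ.var x
  | get a i => σ.arr a (i.eval σ)
  | add e f => e.eval σ + f.eval σ
  | sub e f => e.eval σ - f.eval σ

/-- The number of operations that the evaluation of a word expression takes. -/
def NExp.cost : NExp → ℕ
  | lit _ => 1
  | var _ => 1
  | get _ i => i.cost + 1
  | add e f => e.cost + f.cost + 1
  | sub e f => e.cost + f.cost + 1

/-- The value of a number expression. -/
def QExp.eval (σ : State) : QExp → ℚ≥0
  | zero => 0
  | var x => σ.qvar x
  | get a i => σ.qarr a (i.eval σ)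
  | add e f => e.eval σ + f.eval σ

/-- The number of operations that the evaluation of a number expression takes. -/
def QExp.cost : QExp → ℕ
  | zero => 1
  | var _ => 1
  | get _ i => i.cost + 1
  | add e f => e.cost + f.cost + 1

/-- The outcome of a test. -/
def BExp.Holds (σ : State) : BExp → Prop
  | le e f => e.eval σ ≤ f.eval σ
  | qle e f => e.eval σ ≤ f.eval σ
  | not b => ¬ b.Holds σ
  | and b d => b.Holds σ ∧ d.Holds σ

/-- The number of operations that a test takes. -/
def BExp.cost : BExp → ℕ
  | le e f => e.cost + f.cost + 1
  | qle e f => e.cost + f.cost + 1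
  | not b => b.cost + 1
  | and b d => b.cost + d.cost + 1

/-- Programs. -/
inductive Prog where
  | skip
  | set (x : ℕ) (e : NExp)
  | put (a : ℕ) (i e : NExp)
  | qset (x : ℕ) (e : QExp)
  | qput (a : ℕ) (i : NExp) (e : QExp)
  | seq (c d : Prog)
  | ite (b : BExp) (c d : Prog)
  | while (b : BExp) (c : Prog)

open Function in
/-- `Runs c σ T τ`: started in the memory `σ`, the program `c` halts after exactly `T` steps with
the memory `τ`. -/
inductive Runs : Prog → State → ℕ → State → Prop
  | skip (σ : State) : Runs .skip σ 1 σ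
  | set (σ : State) (x : ℕ) (e : NExp) :
      Runs (.set x e) σ (e.cost + 1) { σ with var := update σ.var x (e.eval σ) }
  | put (σ : State) (a : ℕ) (i e : NExp) :
      Runs (.put a i e) σ (i.cost + e.cost + 1)
        { σ with arr := update σ.arr a (update (σ.arr a) (i.eval σ) (e.eval σ)) }
  | qset (σ : State) (x : ℕ) (e : QExp) :
      Runs (.qset x e) σ (e.cost + 1) { σ with qvar := update σ.qvar x (e.eval σ) }
  | qput (σ : State) (a : ℕ) (i : NExp) (e : QExp) :
      Runs (.qput a i e) σ (i.cost + e.cost + 1)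
        { σ with qarr := update σ.qarr a (update (σ.qarr a) (i.eval σ) (e.eval σ)) }
  | seq {c d : Prog} {σ τ υ : State} {T U : ℕ} :
      Runs c σ T τ → Runs d τ U υ → Runs (.seq c d) σ (T + U) υ
  | ite_true {b : BExp} {c d : Prog} {σ τ : State} {T : ℕ} :
      b.Holds σ → Runs c σ T τ → Runs (.ite b c d) σ (b.cost + T) τ
  | ite_false {b : BExp} {c d : Prog} {σ τ : State} {T : ℕ} :
      ¬ b.Holds σ → Runs d σ T τ → Runs (.ite b c d) σ (b.cost + T) τ
  | while_true {b : BExp} {c : Prog} {σ τ υ : State} {T U : ℕ} :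
      b.Holds σ → Runs c σ T τ → Runs (.while b c) τ U υ →
      Runs (.while b c) σ (b.cost + T + U) υ
  | while_false {b : BExp} {c : Prog} {σ : State} :
      ¬ b.Holds σ → Runs (.while b c) σ b.cost σ

end RAM

open Classical in
/-- The memory that presents the instance `I` to a machine: `n`, `k`, `p` in the word variables
`0`, `1`, `2`; the adjacency matrix, row by row (the entry of `(u, v)` at index `u * n + v`), in the
word array `0`; the terminals `s i` and `t i` in the word arrays `1` and `2`; the lengths of the
arcs in the number array `0`, laid out as the adjacency matrix; zero everywhere else. -/
noncomputable def MVDSP.input (I : MVDSP) : RAM.State where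
  var x := if x = 0 then I.n else if x = 1 then I.k else if x = 2 then I.p else 0
  arr a j :=
    if a = 0 then
      if h : j < I.n * I.n then
        let e := finProdFinEquiv.symm ⟨j, h⟩
        if I.G.Adj e.1 e.2 then 1 else 0
      else 0
    else if a = 1 then if h : j < I.k then (I.s ⟨j, h⟩ : ℕ) else 0
    else if a = 2 then if h : j < I.k then (I.t ⟨j, h⟩ : ℕ) else 0
    else 0
  qvar _ := 0
  qarr a j :=
    if a = 0 then
      if h : j < I.n * I.n then
        let e := finProdFinEquiv.symm ⟨j, h⟩
        if I.G.Adj e.1 e.2 then I.w e.1 e.2 else 0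
      else 0
    else 0

/-- On the instance `I` the program `c` halts within `B` steps with the correct answer in the word
variable `0`: `1` for a yes-instance, `0` for a no-instance. -/
def MVDSP.DecidedBy (I : MVDSP) (c : RAM.Prog) (B : ℕ) : Prop :=
  ∃ T τ, RAM.Runs c I.input T τ ∧ T ≤ B ∧
    (I.IsYes → τ.var 0 = 1) ∧ (¬ I.IsYes → τ.var 0 = 0)

/-! ### The algorithm

A yes-instance has a solution of minimum size with exactly `p` paths. Traversed path by path, each
from its end to its start, the vertices of these paths form a walk in a graph of states: a step
either begins another path at its end `t i`, or goes back along an arc that is tight for the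
distances, which the Bellman–Ford algorithm provides. The walk has `m ≤ 2 * ℓ` steps, because every
path has an arc. Conversely, every walk that visits pairwise distinct vertices and completes `p`
paths yields a solution.

To detect such walks, sum the square of the Vandermonde determinant of the visited vertices over
all walks with `m` steps. The squares are nonnegative, so the sum is nonzero if and only if some
walk visits pairwise distinct vertices. Laplace expansion of both determinants along the row of the
last vertex makes the sums a dynamic program over the last state and a pair of column sets, hence
over `4 ^ m` times polynomially many entries. Increasing `m` until a walk is found or `m` exceeds
`n` takes `2 ^ O(ℓ) * poly(n + k)` steps. -/

namespace RAM

/-- An upper bound for the number of steps of a program all of whose loops make at most `N`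
rounds. -/
def Prog.bound (N : ℕ) : Prog → ℕ
  | .skip => 1
  | .set _ e => e.cost + 1
  | .put _ i e => i.cost + e.cost + 1
  | .qset _ e => e.cost + 1
  | .qput _ i e => i.cost + e.cost + 1
  | .seq c d => c.bound N + d.bound N
  | .ite b c d => b.cost + c.bound N + d.bound N
  | .while b c => N * (b.cost + c.bound N) + b.cost

theorem add_mul_pow_le (a b N : ℕ) :
    a * (N + 1) ^ a + b * (N + 1) ^ b ≤ (a + b) * (N + 1) ^ (a + b) := by
  rw [add_mul]
  gcongr <;> omega

theorem Prog.exists_bound_le (c : Prog) : ∃ C, ∀ N, c.bound N ≤ C * (N + 1) ^ C := by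
  have const (a N : ℕ) : a ≤ a * (N + 1) ^ a := Nat.le_mul_of_pos_right _ (by positivity)
  induction c with
  | skip => exact ⟨1, const 1⟩
  | set => exact ⟨_, const _⟩
  | put => exact ⟨_, const _⟩
  | qset => exact ⟨_, const _⟩
  | qput => exact ⟨_, const _⟩
  | seq c d hc hd =>
    obtain ⟨C, hC⟩ := hc
    obtain ⟨D, hD⟩ := hd
    exact ⟨C + D, fun N ↦ (add_le_add (hC N) (hD N)).trans (add_mul_pow_le C D N)⟩
  | ite b c d hc hd =>
    obtain ⟨C, hC⟩ := hc
    obtain ⟨D, hD⟩ := hd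
    exact ⟨b.cost + C + D, fun N ↦
      (add_le_add (add_le_add (const _ N) (hC N)) (hD N)).trans
        ((Nat.add_le_add_right (add_mul_pow_le _ _ N) _).trans (add_mul_pow_le _ _ N))⟩
  | _ b c hc =>
    obtain ⟨C, hC⟩ := hc
    refine ⟨b.cost + C + 1 + b.cost, fun N ↦
      (Nat.add_le_add ?_ (const b.cost N)).trans (add_mul_pow_le _ _ N)⟩
    calc N * (b.cost + c.bound N)
        ≤ (N + 1) * ((b.cost + C) * (N + 1) ^ (b.cost + C)) := by
          gcongr
          · exact N.le_succ
          · exact (add_le_add (const _ N) (hC N)).trans (add_mul_pow_le _ _ N)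
      _ = (b.cost + C) * (N + 1) ^ (b.cost + C + 1) := by ring
      _ ≤ (b.cost + C + 1) * (N + 1) ^ (b.cost + C + 1) :=
        Nat.mul_le_mul_right _ (Nat.le_succ _)

/-- A piece of the memory that a program names: a variable or a whole array. -/
inductive Loc
  | var (x : ℕ)
  | arr (a : ℕ)
  | qvar (x : ℕ)
  | qarr (a : ℕ)
  deriving DecidableEq

/-- Whether a program contains an assignment to a location. The value is a `Bool` so that it can
be computed for concrete programs. -/
def Prog.writes : Prog → Loc → Bool
  | .skip, _ => false
  | .set x _, l => l = .var x
  | .put a _ _, l => l = .arr a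
  | .qset x _, l => l = .qvar x
  | .qput a _ _, l => l = .qarr a
  | .seq c d, l => c.writes l || d.writes l
  | .ite _ c d, l => c.writes l || d.writes l
  | .while _ c, l => c.writes l

/-- Two memories have the same contents at a location. -/
def State.EqAt (σ τ : State) : Loc → Prop
  | .var x => σ.var x = τ.var x
  | .arr a => σ.arr a = τ.arr a
  | .qvar x => σ.qvar x = τ.qvar x
  | .qarr a => σ.qarr a = τ.qarr a

/-- The memory `τ` agrees with `σ` wherever `c` does not write. -/
def Frame (c : Prog) (σ τ : State) : Prop := ∀ l, c.writes l = false → τ.EqAt σ l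

section Frame

variable {c d : Prog} {σ τ υ : State}

theorem State.EqAt.trans {l : Loc} (h : υ.EqAt τ l) (h' : τ.EqAt σ l) : υ.EqAt σ l := by
  cases l <;> exact Eq.trans h h'

theorem Frame.rfl : Frame c σ σ := fun l _ ↦ by cases l <;> exact Eq.refl _

theorem Frame.trans (h : Frame c σ τ) (h' : Frame c τ υ) : Frame c σ υ :=
  fun l hl ↦ (h' l hl).trans (h l hl)

theorem Frame.mono (h : Frame c σ τ) (hcd : ∀ l, d.writes l = false → c.writes l = false) :
    Frame d σ τ :=
  fun l hl ↦ h l (hcd l hl)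

theorem Frame.seq_left (h : Frame c σ τ) : Frame (.seq c d) σ τ :=
  h.mono fun _ hl ↦ (Bool.or_eq_false_iff.1 hl).1

theorem Frame.seq_right (h : Frame d σ τ) : Frame (.seq c d) σ τ :=
  h.mono fun _ hl ↦ (Bool.or_eq_false_iff.1 hl).2

theorem Frame.var (h : Frame c σ τ) {x : ℕ} (hx : c.writes (.var x) = false) :
    τ.var x = σ.var x :=
  h _ hx

theorem Frame.arr (h : Frame c σ τ) {a : ℕ} (ha : c.writes (.arr a) = false) :
    τ.arr a = σ.arr a :=
  h _ ha

theorem Frame.qarr (h : Frame c σ τ) {a : ℕ} (ha : c.writes (.qarr a) = false) :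
    τ.qarr a = σ.qarr a :=
  h _ ha

theorem Runs.frame {T : ℕ} (h : Runs c σ T τ) : Frame c σ τ := by
  induction h with
  | skip | while_false => exact .rfl
  | set | put | qset | qput =>
    intro l hl
    cases l <;> first
      | exact Eq.refl _
      | exact Function.update_of_ne (by simpa [Prog.writes] using hl) _ _
  | seq _ _ hc hd => exact hc.seq_left.trans hd.seq_right
  | ite_true _ _ h => exact h.mono fun _ hl ↦ (Bool.or_eq_false_iff.1 hl).1
  | ite_false _ _ h => exact h.mono fun _ hl ↦ (Bool.or_eq_false_iff.1 hl).2
  | while_true _ _ _ hc hw => exact (hc.mono fun _ hl ↦ hl).trans hw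

end Frame

section Update

/-- `σ` with `v` assigned to the word variable `x`. -/
def State.setVar (σ : State) (x v : ℕ) : State := { σ with var := Function.update σ.var x v }

/-- `σ` with `v` assigned to the `i`-th entry of the word array `a`. -/
def State.setArr (σ : State) (a i v : ℕ) : State :=
  { σ with arr := Function.update σ.arr a (Function.update (σ.arr a) i v) }

/-- `σ` with `v` assigned to the `i`-th entry of the number array `a`. -/
def State.setQArr (σ : State) (a i : ℕ) (v : ℚ≥0) : State :=
  { σ with qarr := Function.update σ.qarr a (Function.update (σ.qarr a) i v) }

variable (σ : State) (x y v a i b : ℕ) (w : ℚ≥0)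

@[simp] theorem State.setVar_var :
    (σ.setVar x v).var y = if y = x then v else σ.var y :=
  Function.update_apply ..

@[simp] theorem State.setVar_arr : (σ.setVar x v).arr = σ.arr := rfl

@[simp] theorem State.setArr_var : (σ.setArr a i v).var = σ.var := rfl

@[simp] theorem State.setArr_arr :
    (σ.setArr a i v).arr b = if b = a then Function.update (σ.arr a) i v else σ.arr b :=
  Function.update_apply ..

@[simp] theorem State.setArr_qarr : (σ.setArr a i v).qarr = σ.qarr := rfl

@[simp] theorem State.setQArr_arr : (σ.setQArr a i w).arr = σ.arr := rfl

@[simp] theorem State.setQArr_qarr :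
    (σ.setQArr a i w).qarr b = if b = a then Function.update (σ.qarr a) i w else σ.qarr b :=
  Function.update_apply ..

end Update

section Tests

variable {σ : State}

attribute [simp] NExp.eval QExp.eval

/-- `e < f` as a test. -/
def BExp.lt (e f : NExp) : BExp := .not (.le f e)

/-- Equality of words as a test. -/
def BExp.eq (e f : NExp) : BExp := .and (.le e f) (.le f e)

/-- Disjunction of tests. -/
def BExp.or (b d : BExp) : BExp := .not (.and (.not b) (.not d))

@[simp] theorem BExp.holds_le {e f : NExp} : (BExp.le e f).Holds σ ↔ e.eval σ ≤ f.eval σ := .rfl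

@[simp] theorem BExp.holds_qle {e f : QExp} :
    (BExp.qle e f).Holds σ ↔ e.eval σ ≤ f.eval σ := .rfl

@[simp] theorem BExp.holds_not {b : BExp} : (BExp.not b).Holds σ ↔ ¬ b.Holds σ := .rfl

@[simp] theorem BExp.holds_and {b d : BExp} :
    (BExp.and b d).Holds σ ↔ b.Holds σ ∧ d.Holds σ := .rfl

@[simp] theorem BExp.holds_lt {e f : NExp} : (BExp.lt e f).Holds σ ↔ e.eval σ < f.eval σ := by
  simp [BExp.lt]

@[simp] theorem BExp.holds_eq {e f : NExp} : (BExp.eq e f).Holds σ ↔ e.eval σ = f.eval σ := by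
  simp [BExp.eq, le_antisymm_iff]

@[simp] theorem BExp.holds_or {b d : BExp} : (BExp.or b d).Holds σ ↔ b.Holds σ ∨ d.Holds σ := by
  simp [BExp.or, or_iff_not_and_not]

end Tests

/-- Started in `σ`, the program `c` halts within `c.bound N` steps in a memory that satisfies
`Q`. -/
def Exec (N : ℕ) (c : Prog) (σ : State) (Q : State → Prop) : Prop :=
  ∃ T τ, Runs c σ T τ ∧ T ≤ c.bound N ∧ Q τ

section Rules

variable {N : ℕ} {σ : State} {Q R : State → Prop} {c d : Prog}

theorem Exec.mono (h : Exec N c σ R) (hRQ : ∀ τ, Frame c σ τ → R τ → Q τ) : Exec N c σ Q := by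
  obtain ⟨T, τ, hrun, hT, hτ⟩ := h
  exact ⟨T, τ, hrun, hT, hRQ τ hrun.frame hτ⟩

theorem Exec.skip (h : Q σ) : Exec N .skip σ Q := ⟨_, _, .skip σ, le_rfl, h⟩

theorem Exec.set {x : ℕ} {e : NExp} (h : Q (σ.setVar x (e.eval σ))) : Exec N (.set x e) σ Q :=
  ⟨_, _, .set σ x e, le_rfl, h⟩

theorem Exec.put {a : ℕ} {i e : NExp} (h : Q (σ.setArr a (i.eval σ) (e.eval σ))) :
    Exec N (.put a i e) σ Q :=
  ⟨_, _, .put σ a i e, le_rfl, h⟩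

theorem Exec.qput {a : ℕ} {i : NExp} {e : QExp} (h : Q (σ.setQArr a (i.eval σ) (e.eval σ))) :
    Exec N (.qput a i e) σ Q :=
  ⟨_, _, .qput σ a i e, le_rfl, h⟩

theorem Exec.seq (h : Exec N c σ fun τ ↦ Exec N d τ Q) : Exec N (.seq c d) σ Q := by
  obtain ⟨_, _, hc, hT, _, _, hd, hU, hQ⟩ := h
  exact ⟨_, _, .seq hc hd, add_le_add hT hU, hQ⟩

theorem Exec.ite {b : BExp} (hc : b.Holds σ → Exec N c σ Q) (hd : ¬ b.Holds σ → Exec N d σ Q) :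
    Exec N (.ite b c d) σ Q := by
  by_cases hb : b.Holds σ
  · obtain ⟨_, _, hrun, hT, hQ⟩ := hc hb
    exact ⟨_, _, .ite_true hb hrun, by simp only [Prog.bound]; omega, hQ⟩
  · obtain ⟨_, _, hrun, hT, hQ⟩ := hd hb
    exact ⟨_, _, .ite_false hb hrun, by simp only [Prog.bound]; omega, hQ⟩

theorem Exec.while {b : BExp} {M : ℕ} (Inv : ℕ → State → Prop) (hM : M ≤ N)
    (test : ∀ i ≤ M, ∀ τ, Frame (.while b c) σ τ → Inv i τ → (b.Holds τ ↔ i < M))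
    (start : Inv 0 σ)
    (step : ∀ i < M, ∀ τ, Frame (.while b c) σ τ → Inv i τ → Exec N c τ (Inv (i + 1))) :
    Exec N (.while b c) σ (Inv M) := by
  have rounds (r : ℕ) : ∀ i τ, i + r = M → Frame (.while b c) σ τ → Inv i τ →
      ∃ T υ, Runs (.while b c) τ T υ ∧ T ≤ r * (b.cost + c.bound N) + b.cost ∧ Inv M υ := by
    induction r with
    | zero =>
      rintro i τ rfl hframe hτ
      exact ⟨_, τ, .while_false (by simp [test i le_rfl τ hframe hτ]), by simp, hτ⟩
    | succ r ih =>
      intro i τ hi hframe hτ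
      obtain ⟨T, υ, hc, hT, hυ⟩ := step i (by omega) τ hframe hτ
      obtain ⟨U, ω, hw, hU, hω⟩ :=
        ih (i + 1) υ (by omega) (hframe.trans (hc.frame.mono fun _ hl ↦ hl)) hυ
      refine ⟨_, ω, .while_true ((test i (by omega) τ hframe hτ).2 (by omega)) hc hw, ?_, hω⟩
      rw [Nat.succ_mul]
      omega
  obtain ⟨T, τ, hrun, hT, hτ⟩ := rounds M 0 σ (by omega) .rfl start
  exact ⟨T, τ, hrun, hT.trans (by simp only [Prog.bound]; gcongr), hτ⟩

theorem Frame.setVar {x v : ℕ} (hx : c.writes (.var x) = true) : Frame c σ (σ.setVar x v) :=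
  (Runs.set σ x (.lit v)).frame.mono fun l hl ↦ by
    have : l ≠ .var x := by rintro rfl; simp [hx] at hl
    simpa [Prog.writes]

/-- `for x = 0, …, e - 1 do c`. -/
def Prog.forLoop (x : ℕ) (e : NExp) (c : Prog) : Prog :=
  .seq (.set x (.lit 0))
    (.while (.lt (.var x) e) (.seq c (.set x (.add (.var x) (.lit 1)))))

theorem Frame.forLoop {x : ℕ} {e : NExp} {τ : State}
    (h : Frame c σ τ) : Frame (.forLoop x e c) σ τ :=
  h.mono fun l hl ↦ by simp_all [Prog.forLoop, Prog.writes]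

theorem Exec.forLoop {M x : ℕ} {e : NExp} (Inv : ℕ → State → Prop) (hM : M ≤ N)
    (counter : c.writes (.var x) = false)
    (limit : ∀ τ, Frame (.forLoop x e c) σ τ → e.eval τ = M)
    (stable : ∀ i τ v, Inv i τ → Inv i (τ.setVar x v)) (start : Inv 0 σ)
    (step : ∀ i < M, ∀ τ, Frame (.forLoop x e c) σ τ → τ.var x = i → Inv i τ →
      Exec N c τ (Inv (i + 1))) :
    Exec N (.forLoop x e c) σ (Inv M) := by
  have start_frame : Frame (.forLoop x e c) σ (σ.setVar x 0) :=
    .setVar (by simp [Prog.forLoop, Prog.writes])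
  refine .seq (.set ((Exec.while (fun i τ ↦ τ.var x = i ∧ Inv i τ) hM ?_ ?_ ?_).mono
    fun _ _ h ↦ h.2))
  · rintro i - τ hframe ⟨hx, -⟩
    simp [limit τ (start_frame.trans hframe.seq_right), hx]
  · exact ⟨by simp, stable _ _ _ start⟩
  · rintro i hi τ hframe ⟨hx, hτ⟩
    exact .seq ((step i hi τ (start_frame.trans hframe.seq_right) hx hτ).mono fun υ hυ hInv ↦
      .set ⟨by simp [hυ.var counter, hx], stable _ _ _ hInv⟩)

theorem Exec.forLoop₃ {A B C x y z : ℕ} {e f g : NExp} (Inv : ℕ → State → Prop)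
    (hA : A ≤ N) (hB : B ≤ N) (hC : C ≤ N)
    (counter : [x, y, z].Nodup ∧ ∀ r ∈ [x, y, z], c.writes (.var r) = false)
    (limit : ∀ τ, Frame (.forLoop x e (.forLoop y f (.forLoop z g c))) σ τ →
      e.eval τ = A ∧ f.eval τ = B ∧ g.eval τ = C)
    (stable : ∀ i τ v, ∀ r ∈ [x, y, z], Inv i τ → Inv i (τ.setVar r v)) (start : Inv 0 σ)
    (step : ∀ i < A, ∀ j < B, ∀ l < C, ∀ τ,
      Frame (.forLoop x e (.forLoop y f (.forLoop z g c))) σ τ →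
      τ.var x = i → τ.var y = j → τ.var z = l → Inv ((i * B + j) * C + l) τ →
      Exec N c τ (Inv ((i * B + j) * C + l + 1))) :
    Exec N (.forLoop x e (.forLoop y f (.forLoop z g c))) σ (Inv (A * B * C)) := by
  simp only [List.nodup_cons, List.mem_cons, List.not_mem_nil, or_false, not_or, forall_eq_or_imp,
    forall_eq] at counter stable
  obtain ⟨⟨⟨hxy, hxz⟩, hyz, -⟩, hx, hy, hz⟩ := counter
  have stable_x i τ v := (stable i τ v).1
  have stable_y i τ v := (stable i τ v).2.1
  have stable_z i τ v := (stable i τ v).2.2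
  refine .forLoop (fun i ↦ Inv (i * B * C)) hA ?_ (fun τ hτ ↦ (limit τ hτ).1)
    (fun i ↦ stable_x _) (by simpa using start) fun i hi τ hτ hxi hInv ↦ ?_
  · simp [Prog.forLoop, Prog.writes, hx, hxy, hxz]
  refine (Exec.forLoop (fun j ↦ Inv ((i * B + j) * C)) hB ?_
    (fun υ hυ ↦ (limit υ (hτ.trans hυ.forLoop)).2.1) (fun j ↦ stable_y _) (by simpa using hInv)
    fun j hj υ hυ hyj hInv ↦ ?_).mono fun _ _ h ↦ by rwa [add_one_mul]
  · simp [Prog.forLoop, Prog.writes, hy, hyz]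
  refine (Exec.forLoop (fun l ↦ Inv ((i * B + j) * C + l)) hC hz
    (fun ω hω ↦ (limit ω ((hτ.trans hυ.forLoop).trans hω.forLoop.forLoop)).2.2)
    (fun l ↦ stable_z _) hInv fun l hl ω hω hzl ↦ ?_).mono
      fun _ _ h ↦ by rwa [← add_assoc, add_one_mul (i * B + j)]
  refine step i hi j hj l hl ω ((hτ.trans hυ.forLoop).trans hω.forLoop.forLoop) ?_ ?_ hzl
  · rw [hω.var (by simp [Prog.forLoop, Prog.writes, hx, hxz]),
      hυ.var (by simp [Prog.forLoop, Prog.writes, hx, hxy, hxz]), hxi]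
  · rw [hω.var (by simp [Prog.forLoop, Prog.writes, hy, hyz]), hyj]

end Rules

end RAM

section VandermondeMinor

open Finset

/-- The sum over `X` with alternating signs, the smallest element of `X` coming with sign `+`. -/
def alternatingSum {M : Type*} [Ring M] (X : Finset ℕ) (g : ℕ → M) : M :=
  ∑ a ∈ X, (-1) ^ #{c ∈ X | c < a} * g a

theorem alternatingSum_congr {M : Type*} [Ring M] {X : Finset ℕ} {f g : ℕ → M}
    (h : ∀ a ∈ X, f a = g a) : alternatingSum X f = alternatingSum X g :=
  Finset.sum_congr rfl fun a ha ↦ by rw [h a ha]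

theorem alternatingSum_insert {M : Type*} [Ring M] {X : Finset ℕ} {b : ℕ} (hb : ∀ a ∈ X, b < a)
    (g : ℕ → M) : alternatingSum (insert b X) g = g b - alternatingSum X g := by
  have hbX : b ∉ X := fun h ↦ (hb b h).false
  have below_b : {c ∈ insert b X | c < b} = ∅ :=
    filter_eq_empty_iff.2 <| forall_mem_insert .. |>.2 ⟨lt_irrefl b, fun a ha ↦ (hb a ha).not_gt⟩
  rw [alternatingSum, alternatingSum, sum_insert hbX, below_b, sub_eq_add_neg, ← sum_neg_distrib]
  congr 1
  · simp
  refine sum_congr rfl fun a ha ↦ ?_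
  rw [filter_insert, if_pos (hb a ha), card_insert_of_notMem (by simp [hbX]), pow_succ]
  simp

theorem alternatingSum_filter_le {M : Type*} [Ring M] (X : Finset ℕ) (b : ℕ) (g : ℕ → M) :
    alternatingSum {a ∈ X | b ≤ a} g = if b ∈ X then g b - alternatingSum {a ∈ X | b + 1 ≤ a} g
      else alternatingSum {a ∈ X | b + 1 ≤ a} g := by
  split_ifs with hb
  · have above : ∀ a ∈ X.filter (b + 1 ≤ ·), b < a := by simp
    rw [← alternatingSum_insert above]
    congr 1
    grind
  · congr 1
    grind

variable {R : Type*} [CommRing R]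

/-- The minor of the matrix with rows `(x ^ 0, x ^ 1, x ^ 2, …)`, for `x` in the list `l`, that
consists of the columns in `X`. The value is `0` if this is not a square matrix. -/
def vandermondeMinor (l : List R) (X : Finset ℕ) : R :=
  if h : #X = l.length then Matrix.det (.of fun i j ↦ l.get i ^ X.orderEmbOfFin h j) else 0

theorem orderEmbOfFin_erase {X : Finset ℕ} {r : ℕ} (hX : #X = r + 1) (j : Fin (r + 1))
    (h : #(X.erase (X.orderEmbOfFin hX j)) = r) (i : Fin r) :
    (X.erase (X.orderEmbOfFin hX j)).orderEmbOfFin h i = X.orderEmbOfFin hX (j.succAbove i) := by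
  have := orderEmbOfFin_unique h (f := fun i ↦ X.orderEmbOfFin hX (j.succAbove i))
    (fun i ↦ by simp [Fin.succAbove_ne]) fun i i' hii' ↦
      (X.orderEmbOfFin hX).strictMono (Fin.strictMono_succAbove j hii')
  exact (congrFun this i).symm

theorem card_filter_lt_orderEmbOfFin {X : Finset ℕ} {r : ℕ} (hX : #X = r) (j : Fin r) :
    #{c ∈ X | c < X.orderEmbOfFin hX j} = j := by
  conv_lhs => enter [1, 2]; rw [← X.map_orderEmbOfFin_univ hX]
  rw [filter_map, card_map]
  simp [← Fin.card_Iio, filter_gt_eq_Iio]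

theorem alternatingSum_mul_alternatingSum (X Y : Finset ℕ) (f g : ℕ → R) :
    alternatingSum X f * alternatingSum Y g =
      alternatingSum Y fun b ↦ alternatingSum X fun a ↦ f a * g b := by
  rw [alternatingSum, alternatingSum, sum_mul_sum, sum_comm]
  simp only [alternatingSum, mul_sum]
  exact sum_congr rfl fun b _ ↦ sum_congr rfl fun a _ ↦ by ring

theorem sum_map_alternatingSum {ι : Type*} (s : Multiset ι) (X : Finset ℕ) (f : ι → ℕ → R) :
    (s.map fun i ↦ alternatingSum X (f i)).sum =
      alternatingSum X fun a ↦ (s.map fun i ↦ f i a).sum := by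
  simp only [alternatingSum, Multiset.sum_map_sum, Multiset.sum_map_mul_left]

theorem vandermondeMinor_cons (x : R) (l : List R) (X : Finset ℕ) :
    vandermondeMinor (x :: l) X =
      alternatingSum X fun a ↦ x ^ a * vandermondeMinor l (X.erase a) := by
  by_cases hX : #X = l.length + 1
  · refine (dif_pos hX).trans ?_
    rw [alternatingSum]
    conv_rhs => enter [1]; rw [← X.map_orderEmbOfFin_univ hX]
    rw [sum_map, Matrix.det_succ_row_zero]
    refine sum_congr rfl fun j _ ↦ ?_
    have hcard : #(X.erase (X.orderEmbOfFin hX j)) = l.length := by simp [hX]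
    rw [mul_assoc]
    simp only [RelEmbedding.coe_toEmbedding, card_filter_lt_orderEmbOfFin, vandermondeMinor,
      dif_pos hcard, orderEmbOfFin_erase]
    rfl
  · rw [vandermondeMinor, dif_neg (by simpa using hX)]
    refine (sum_eq_zero fun a ha ↦ ?_).symm
    have : #(X.erase a) ≠ l.length := by
      rw [card_erase_of_mem ha]
      have := card_pos.2 ⟨a, ha⟩
      lia
    simp [vandermondeMinor, this]

theorem vandermondeMinor_nil (X : Finset ℕ) :
    vandermondeMinor ([] : List R) X = if X = ∅ then 1 else 0 := by
  by_cases hX : X = ∅ <;> simp [vandermondeMinor, hX]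

theorem vandermondeMinor_eq_zero_of_not_nodup {l : List R} (hl : ¬ l.Nodup) (X : Finset ℕ) :
    vandermondeMinor l X = 0 := by
  rw [vandermondeMinor]
  split_ifs with hX
  · obtain ⟨i, j, hij, hne⟩ := Function.not_injective_iff.1 (mt List.nodup_iff_injective_get.2 hl)
    exact Matrix.det_zero_of_row_eq hne (by
      simp only [Matrix.of_apply, funext_iff, hij, implies_true])
  · rfl

theorem vandermondeMinor_range_ne_zero_iff [IsDomain R] {l : List R} :
    vandermondeMinor l (range l.length) ≠ 0 ↔ l.Nodup := by
  rw [List.nodup_iff_injective_get, ← Matrix.det_vandermonde_ne_zero_iff, vandermondeMinor,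
    dif_pos (card_range _)]
  have (j : Fin l.length) : (range l.length).orderEmbOfFin (card_range _) j = j :=
    (congrFun (orderEmbOfFin_unique (card_range _) (f := Fin.val) (by simp) fun _ _ h ↦ h) j).symm
  simp only [this]
  rfl

end VandermondeMinor

section Walks

open Finset

variable {α R : Type*} [Fintype α] [DecidableEq α] (step : α → α → Prop) [DecidableRel step]
  (src : α) (lab : α → R)

/-- The label sequences, last label first, of the walks with `r` steps from `src` to `q` along
`step`. The label of the start does not count. -/
def walkLabels : ℕ → α → Multiset (List R)
  | 0, q => if q = src then {[]} else 0
  | r + 1, q => ({q' | step q' q} : Finset α).val.bind fun q' ↦ (walkLabels r q').map (lab q :: ·)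

/-- The sum over all walks with `#X` steps from `src` to `q` of the products of the two minors of
their labels. -/
def walkSum [CommRing R] (X Y : Finset ℕ) (q : α) : R :=
  ((walkLabels step src lab #X q).map fun l ↦ vandermondeMinor l X * vandermondeMinor l Y).sum

variable {step src lab}

theorem mem_walkLabels_succ {r : ℕ} {q : α} {l : List R} :
    l ∈ walkLabels step src lab (r + 1) q ↔
      ∃ q', step q' q ∧ ∃ l' ∈ walkLabels step src lab r q', lab q :: l' = l := by
  simp [walkLabels]

theorem length_of_mem_walkLabels {r : ℕ} {q : α} {l : List R}
    (h : l ∈ walkLabels step src lab r q) : l.length = r := by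
  induction r generalizing q l with
  | zero => simp only [walkLabels] at h; split_ifs at h <;> simp_all
  | succ r ih =>
    obtain ⟨_, _, l', hl', rfl⟩ := mem_walkLabels_succ.1 h
    simp [ih hl']

section CommRing

variable [CommRing R]

theorem walkSum_empty_left (Y : Finset ℕ) (q : α) :
    walkSum step src lab ∅ Y q = if Y = ∅ ∧ q = src then 1 else 0 := by
  by_cases hq : q = src <;> simp [walkSum, walkLabels, hq, vandermondeMinor_nil]

theorem vandermondeMinor_cons_mul (x : R) (l : List R) (X Y : Finset ℕ) :
    vandermondeMinor (x :: l) X * vandermondeMinor (x :: l) Y =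
      alternatingSum Y fun b ↦ alternatingSum X fun a ↦
        x ^ (a + b) * (vandermondeMinor l (X.erase a) * vandermondeMinor l (Y.erase b)) := by
  simp only [vandermondeMinor_cons, alternatingSum_mul_alternatingSum, pow_add, mul_mul_mul_comm]

theorem walkSum_of_card_eq_succ {r : ℕ} {X : Finset ℕ} (hX : #X = r + 1) (Y : Finset ℕ) (q : α) :
    walkSum step src lab X Y q =
      alternatingSum Y fun b ↦ alternatingSum X fun a ↦
        lab q ^ (a + b) * ∑ q' with step q' q, walkSum step src lab (X.erase a) (Y.erase b) q' := by
  simp only [walkSum, hX, walkLabels, Multiset.map_bind, Multiset.sum_bind, Multiset.map_map,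
    Function.comp_def, vandermondeMinor_cons_mul, sum_map_alternatingSum]
  refine alternatingSum_congr fun b _ ↦ alternatingSum_congr fun a ha ↦ ?_
  rw [card_erase_of_mem ha, hX, Nat.add_sub_cancel]
  simp only [Multiset.sum_map_mul_left]
  rfl

theorem walkSum_eq (X Y : Finset ℕ) (q : α) :
    walkSum step src lab X Y q = (if X = ∅ ∧ Y = ∅ ∧ q = src then 1 else 0) +
      alternatingSum Y fun b ↦ alternatingSum X fun a ↦
        lab q ^ (a + b) * ∑ q' with step q' q, walkSum step src lab (X.erase a) (Y.erase b) q' := by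
  rcases X.eq_empty_or_nonempty with rfl | hX
  · simp [walkSum_empty_left, alternatingSum]
  · obtain ⟨r, hr⟩ := Nat.exists_eq_succ_of_ne_zero hX.card_ne_zero
    rw [walkSum_of_card_eq_succ hr, if_neg (by simp [hX.ne_empty]), zero_add]

theorem walkSum_range_ne_zero_iff [LinearOrder R] [IsStrictOrderedRing R] {m : ℕ} {q : α} :
    walkSum step src lab (range m) (range m) q ≠ 0 ↔
      ∃ l ∈ walkLabels step src lab m q, l.Nodup := by
  have minor_ne_zero_iff {l : List R} (hl : l ∈ walkLabels step src lab m q) :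
      vandermondeMinor l (range m) ≠ 0 ↔ l.Nodup := by
    rw [← length_of_mem_walkLabels hl, vandermondeMinor_range_ne_zero_iff]
  rw [walkSum, card_range]
  constructor
  · contrapose!
    intro h
    refine Multiset.sum_eq_zero fun x hx ↦ ?_
    obtain ⟨l, hl, rfl⟩ := Multiset.mem_map.1 hx
    rw [vandermondeMinor_eq_zero_of_not_nodup (h l hl), zero_mul]
  · rintro ⟨l, hl, hnodup⟩ hsum
    refine (minor_ne_zero_iff hl).2 hnodup (mul_self_eq_zero.1 ?_)
    refine Multiset.all_zero_of_le_zero_le_of_sum_eq_zero ?_ hsum _ (Multiset.mem_map_of_mem _ hl)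
    simp [mul_self_nonneg]

end CommRing

end Walks

section BitSet

/-- The set of the positions of the ones in the binary expansion of `x`. -/
def bitSet (x : ℕ) : Finset ℕ := x.bitIndices.toFinset

theorem sum_bitSet (x : ℕ) : ∑ a ∈ bitSet x, 2 ^ a = x := Finset.sum_toFinset_bitIndices_two_pow x

theorem bitSet_sum (S : Finset ℕ) : bitSet (∑ a ∈ S, 2 ^ a) = S :=
  Finset.toFinset_bitIndices_sum_two_pow S

theorem bitSet_sub {x a : ℕ} (h : a ∈ bitSet x) : bitSet (x - 2 ^ a) = (bitSet x).erase a := by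
  have hx := Finset.add_sum_erase (bitSet x) (2 ^ ·) h
  rw [sum_bitSet] at hx
  rw [← bitSet_sum ((bitSet x).erase a)]
  congr 1
  lia

theorem mem_bitSet_iff_div {x a : ℕ} : a ∈ bitSet x ↔ x / 2 ^ a % 2 = 1 := by
  rw [bitSet, List.mem_toFinset, Nat.mem_bitIndices, Nat.testBit_eq_decide_div_mod_eq,
    decide_eq_true_iff]

theorem mod_two_pow_of_mem_bitSet {x a : ℕ} (h : a ∈ bitSet x) :
    x % 2 ^ (a + 1) = 2 ^ a + x % 2 ^ a := by
  rw [Nat.mod_pow_succ, mem_bitSet_iff_div.1 h, mul_one, add_comm]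

theorem mod_two_pow_of_notMem_bitSet {x a : ℕ} (h : a ∉ bitSet x) :
    x % 2 ^ (a + 1) = x % 2 ^ a := by
  rw [mem_bitSet_iff_div, ← ne_eq, Nat.mod_two_ne_one] at h
  rw [Nat.mod_pow_succ, h, mul_zero, add_zero]

theorem mem_bitSet {x a : ℕ} : a ∈ bitSet x ↔ 2 ^ a ≤ x % 2 ^ (a + 1) := by
  refine ⟨fun h ↦ ?_, fun h ↦ ?_⟩
  · simp [mod_two_pow_of_mem_bitSet h]
  · contrapose! h
    rw [mod_two_pow_of_notMem_bitSet h]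
    exact Nat.mod_lt _ (by positivity)

theorem two_pow_le_of_mem_bitSet {x a : ℕ} (h : a ∈ bitSet x) : 2 ^ a ≤ x :=
  (mem_bitSet.1 h).trans (Nat.mod_le _ _)

theorem lt_of_mem_bitSet {x a m : ℕ} (hx : x < 2 ^ m) (h : a ∈ bitSet x) : a < m :=
  (Nat.pow_lt_pow_iff_right one_lt_two).1 ((two_pow_le_of_mem_bitSet h).trans_lt hx)

theorem bitSet_two_pow_sub_one (m : ℕ) : bitSet (2 ^ m - 1) = Finset.range m := by
  rw [← bitSet_sum (Finset.range m), Nat.geomSum_eq le_rfl, Nat.div_one]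

theorem bitSet_eq_empty_iff {x : ℕ} : bitSet x = ∅ ↔ x = 0 := by
  refine ⟨fun h ↦ ?_, fun h ↦ by simp [h, bitSet]⟩
  rw [← sum_bitSet x, h, Finset.sum_empty]

end BitSet

namespace MVDSP

variable {I : MVDSP}

section ShortestPath

variable {u v t : Fin I.n}

theorem pathLength_cons_cons (u v : Fin I.n) (l : List (Fin I.n)) :
    I.pathLength (u :: v :: l) = I.w u v + I.pathLength (v :: l) := by
  simp [pathLength]

theorem pathLength_le_cons (u : Fin I.n) (l : List (Fin I.n)) :
    I.pathLength l ≤ I.pathLength (u :: l) := by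
  cases l with
  | nil => simp [pathLength]
  | cons v l => simp [pathLength_cons_cons]

theorem pathLength_le_append (A B : List (Fin I.n)) : I.pathLength B ≤ I.pathLength (A ++ B) := by
  induction A with
  | nil => rfl
  | cons a A ih => exact ih.trans (pathLength_le_cons a _)

theorem IsPath.exists_eq_cons {P : List (Fin I.n)} (h : I.IsPath u t P) : ∃ l, P = u :: l :=
  List.head?_eq_some_iff.1 h.1

theorem isShortestPath_singleton (t : Fin I.n) : I.IsShortestPath t t [t] :=
  ⟨by simp [IsPath], fun Q _ ↦ by simp [pathLength]⟩

theorem isPath_cons_cons {u' : Fin I.n} {l : List (Fin I.n)} :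
    I.IsPath u t (u' :: v :: l) ↔ u = u' ∧ I.G.Adj u v ∧ u ∉ v :: l ∧ I.IsPath v t (v :: l) := by
  simp only [IsPath, List.head?_cons, Option.some.injEq, List.getLast?_cons_cons,
    List.isChain_cons_cons, List.nodup_cons (a := u'), true_and]
  constructor
  · rintro ⟨rfl, hlast, ⟨hadj, hchain⟩, hu, hnodup⟩
    exact ⟨rfl, hadj, hu, hlast, hchain, hnodup⟩
  · rintro ⟨rfl, hadj, hu, hlast, hchain, hnodup⟩
    exact ⟨rfl, hlast, ⟨hadj, hchain⟩, hu, hnodup⟩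

theorem IsPath.cons {P : List (Fin I.n)} (hP : I.IsPath v t P) (hadj : I.G.Adj u v) (hu : u ∉ P) :
    I.IsPath u t (u :: P) ∧ I.pathLength (u :: P) = I.w u v + I.pathLength P := by
  obtain ⟨l, rfl⟩ := hP.exists_eq_cons
  exact ⟨isPath_cons_cons.2 ⟨rfl, hadj, hu, hP⟩, pathLength_cons_cons ..⟩

theorem IsPath.exists_isPath_of_adj {P : List (Fin I.n)} (hP : I.IsPath v t P)
    (hadj : I.G.Adj u v) :
    ∃ P', I.IsPath u t P' ∧ I.pathLength P' ≤ I.w u v + I.pathLength P := by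
  by_cases hu : u ∈ P
  · obtain ⟨A, B, rfl⟩ := List.append_of_mem hu
    refine ⟨u :: B, ⟨rfl, ?_, ?_, ?_⟩,
      (pathLength_le_append A _).trans (le_add_of_nonneg_left zero_le)⟩
    · rw [← hP.2.1, List.getLast?_append_of_ne_nil _ (List.cons_ne_nil u B)]
    · exact hP.2.2.1.suffix (List.suffix_append ..)
    · exact hP.2.2.2.sublist (List.sublist_append_right ..)
  · exact ⟨_, (hP.cons hadj hu).1, (hP.cons hadj hu).2.le⟩

theorem IsShortestPath.tail {u' : Fin I.n} {l : List (Fin I.n)}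
    (h : I.IsShortestPath u t (u' :: v :: l)) : I.G.Adj u v ∧ I.IsShortestPath v t (v :: l) := by
  obtain ⟨rfl, hadj, -, hpath⟩ := isPath_cons_cons.1 h.1
  refine ⟨hadj, hpath, fun Q hQ ↦ ?_⟩
  obtain ⟨P, hP, hle⟩ := hQ.exists_isPath_of_adj hadj
  have hlength := (h.2 P hP).trans hle
  rw [pathLength_cons_cons] at hlength
  exact le_of_add_le_add_left hlength

theorem IsShortestPath.length_le {P : List (Fin I.n)} (h : I.IsShortestPath u t P) (hut : u ≠ t) :
    P.length ≤ 2 * (P.length - 1) := by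
  obtain ⟨_ | ⟨v, l⟩, rfl⟩ := h.1.exists_eq_cons
  · exact absurd (by simpa using h.1.2.1) hut
  · simp only [List.length_cons]
    lia

/-- `d u t` is the distance from `u` to `t` whenever `t` can be reached from `u`; otherwise nothing
is required of it. -/
structure IsDist (I : MVDSP) (d : Fin I.n → Fin I.n → ℚ≥0) : Prop where
  le {u t : Fin I.n} {P : List (Fin I.n)} : I.IsPath u t P → d u t ≤ I.pathLength P
  exists_le {u t : Fin I.n} {P : List (Fin I.n)} :
    I.IsPath u t P → ∃ P', I.IsPath u t P' ∧ I.pathLength P' ≤ d u t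

theorem IsDist.eq {d : Fin I.n → Fin I.n → ℚ≥0} (hd : I.IsDist d) {P : List (Fin I.n)}
    (hP : I.IsShortestPath u t P) : d u t = I.pathLength P := by
  obtain ⟨P', hP', hle⟩ := hd.exists_le hP.1
  exact (hd.le hP.1).antisymm ((hP.2 P' hP').trans hle)

end ShortestPath

section Family

/-- A family of shortest paths between terminal pairs, each path listed with the index of its
pair. -/
def IsFamily (I : MVDSP) (F : List (Fin I.k × List (Fin I.n))) : Prop :=
  ∀ f ∈ F, I.IsShortestPath (I.s f.1) (I.t f.1) f.2

/-- The vertices of the paths of a family, path by path. -/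
def vertices (F : List (Fin I.k × List (Fin I.n))) : List (Fin I.n) := (F.map Prod.snd).flatten

variable {F : List (Fin I.k × List (Fin I.n))}

theorem vertices_cons (f : Fin I.k × List (Fin I.n)) (F : List (Fin I.k × List (Fin I.n))) :
    vertices (f :: F) = f.2 ++ vertices F := by
  simp [vertices]

theorem isFamily_cons {f : Fin I.k × List (Fin I.n)} :
    I.IsFamily (f :: F) ↔ I.IsShortestPath (I.s f.1) (I.t f.1) f.2 ∧ I.IsFamily F :=
  List.forall_mem_cons

theorem IsFamily.isYes (hF : I.IsFamily F) (hnodup : (vertices F).Nodup) (hp : F.length = I.p) :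
    I.IsYes := by
  have hdisj : F.Pairwise fun f g ↦ f.2.Disjoint g.2 :=
    List.pairwise_map.1 (List.nodup_flatten.1 hnodup).2
  have : Std.Symm fun f g : Fin I.k × List (Fin I.n) ↦ f.2.Disjoint g.2 :=
    ⟨fun _ _ ↦ List.Disjoint.symm⟩
  have hpairs : (F.map Prod.fst).Nodup := by
    refine List.pairwise_map.2 (hdisj.imp_of_mem fun {f g} hf hg hfg heq ↦ ?_)
    obtain ⟨_, hf⟩ := (hF f hf).1.exists_eq_cons
    obtain ⟨_, hg⟩ := (hF g hg).1.exists_eq_cons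
    exact hfg (a := I.s f.1) (by simp [hf]) (by simp [hg, heq])
  have hmem : ∀ i ∈ (F.map Prod.fst).toFinset, ∃ P, (i, P) ∈ F := by simp
  choose! P hP using hmem
  refine ⟨_, P, ?_, fun i hi ↦ hF _ (hP i hi), fun i hi j hj hij ↦ ?_⟩
  · rw [List.toFinset_card_of_nodup hpairs, List.length_map, hp]
  · exact hdisj.forall (hP i hi) (hP j hj) fun h ↦ hij (congrArg Prod.fst h)

theorem IsSolution.exists_isFamily {S : Finset (Fin I.k)} {P : Fin I.k → List (Fin I.n)}
    (h : I.IsSolution S P) : ∃ F, I.IsFamily F ∧ (vertices F).Nodup ∧ F.length = I.p ∧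
      (vertices F).length ≤ 2 * I.numArcs S P := by
  obtain ⟨hp, hshortest, hdisj⟩ := h
  obtain ⟨S', hS', hcard⟩ := Finset.exists_subset_card_eq hp
  refine ⟨S'.toList.map fun i ↦ (i, P i), ?_, ?_, by simp [hcard], ?_⟩
  · simpa [IsFamily] using fun i hi ↦ hshortest i (hS' hi)
  · refine List.nodup_flatten.2 ⟨?_, ?_⟩
    · simpa using fun i hi ↦ (hshortest i (hS' hi)).1.2.2.2
    · rw [List.map_map, List.pairwise_map]
      exact S'.nodup_toList.imp_of_mem fun {i j} hi hj ↦
        hdisj i (hS' (Finset.mem_toList.1 hi)) j (hS' (Finset.mem_toList.1 hj))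
  · calc (vertices (S'.toList.map fun i ↦ (i, P i))).length
        = ∑ i ∈ S', (P i).length := by
          simp [vertices, List.length_flatten, Function.comp_def]
      _ ≤ ∑ i ∈ S', 2 * ((P i).length - 1) :=
          Finset.sum_le_sum fun i hi ↦ (hshortest i (hS' hi)).length_le (I.s_ne_t i)
      _ ≤ ∑ i ∈ S, 2 * ((P i).length - 1) := Finset.sum_le_sum_of_subset hS'
      _ = 2 * I.numArcs S P := (Finset.mul_sum ..).symm

theorem IsYes.demand_le (h : I.IsYes) : I.p ≤ I.n := by
  obtain ⟨S, P, hcard, hshortest, hdisj⟩ := h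
  have mem_source {i} (hi : i ∈ S) : I.s i ∈ P i := by
    obtain ⟨l, hl⟩ := (hshortest i hi).1.exists_eq_cons
    simp [hl]
  have hinj : Set.InjOn I.s S := fun i hi j hj hij ↦ by_contra fun hne ↦
    hdisj i hi j hj hne (mem_source hi) (hij ▸ mem_source hj)
  simpa using hcard.trans (Finset.card_le_card_of_injOn I.s (fun _ _ ↦ Finset.mem_univ _) hinj)

theorem IsYes.exists_isFamily (h : I.IsYes) : ∃ F, I.IsFamily F ∧ (vertices F).Nodup ∧
    F.length = I.p ∧ (vertices F).length ≤ I.n ∧ (vertices F).length ≤ 2 * I.ell := by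
  have hne : {m | ∃ S P, I.IsSolution S P ∧ I.numArcs S P = m}.Nonempty :=
    let ⟨S, P, hSP⟩ := h; ⟨_, S, P, hSP, rfl⟩
  obtain ⟨S, P, hSP, hell⟩ := Nat.sInf_mem hne
  obtain ⟨F, hF, hnodup, hp, hlength⟩ := hSP.exists_isFamily
  exact ⟨F, hF, hnodup, hp, by simpa using hnodup.length_le_card, by rwa [ell, if_pos h, ← hell]⟩

end Family

section PathState

/-- The progress of a walk through the paths of a family, each path being traversed from its end
to its start: `none` if no path has been begun, and `some (j, i, v)` if `j` paths are complete and
a path of the `i`-th pair has been traversed down to its vertex `v`. -/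
abbrev PathState (I : MVDSP) := Option (Fin I.p × Fin I.k × Fin I.n)

/-- The current vertex, as the row of an integer Vandermonde matrix; `none` has the junk value
`0`. -/
def vertex : I.PathState → ℤ
  | none => 0
  | some (_, _, v) => (v : ℕ)

/-- In this state exactly `r` paths are complete, and no path is incomplete. -/
def Completes (r : ℕ) : I.PathState → Prop
  | none => r = 0
  | some (j, i, v) => r = j + 1 ∧ v = I.s i

/-- The transitions between states: to begin another path, or to proceed backwards along an arc
that lies on a shortest path to the end of the current pair. -/
inductive Step (I : MVDSP) (d : Fin I.n → Fin I.n → ℚ≥0) : I.PathState → I.PathState → Prop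
  | begin {q : I.PathState} {j : Fin I.p} {i : Fin I.k} (hq : Completes j q) :
      Step I d q (some (j, i, I.t i))
  | extend {j : Fin I.p} {i : Fin I.k} {v v' : Fin I.n} (hadj : I.G.Adj v v')
      (hle : I.w v v' + d v' (I.t i) ≤ d v (I.t i)) : Step I d (some (j, i, v')) (some (j, i, v))

noncomputable instance (d : Fin I.n → Fin I.n → ℚ≥0) : DecidableRel (I.Step d) :=
  Classical.decRel _

theorem step_some_iff {d : Fin I.n → Fin I.n → ℚ≥0} {q : I.PathState} {j : Fin I.p} {i : Fin I.k}
    {v : Fin I.n} : I.Step d q (some (j, i, v)) ↔ Completes j q ∧ v = I.t i ∨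
      ∃ v', q = some (j, i, v') ∧ I.G.Adj v v' ∧ I.w v v' + d v' (I.t i) ≤ d v (I.t i) := by
  constructor
  · rintro (hq | ⟨hadj, hle⟩)
    exacts [.inl ⟨hq, rfl⟩, .inr ⟨_, rfl, hadj, hle⟩]
  · rintro (⟨hq, rfl⟩ | ⟨v', rfl, hadj, hle⟩)
    exacts [.begin hq, .extend hadj hle]

/-- Some walk with `m` steps visits pairwise distinct vertices and completes `p` paths. -/
def HasWalk (I : MVDSP) (d : Fin I.n → Fin I.n → ℚ≥0) (m : ℕ) : Prop :=
  ∃ q, Completes I.p q ∧ ∃ l ∈ walkLabels (I.Step d) none vertex m q, l.Nodup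

/-- The vertices in `L` as labels of a walk. -/
def labels (L : List (Fin I.n)) : List ℤ := L.map fun v : Fin I.n ↦ ((v : ℕ) : ℤ)

theorem nodup_labels {L : List (Fin I.n)} : (labels L).Nodup ↔ L.Nodup :=
  List.nodup_map_iff (Nat.cast_injective.comp Fin.val_injective)

/-- The list `l` consists of the labels of the paths traversed when the state is reached. -/
def Traces (l : List ℤ) : I.PathState → Prop
  | none => l = []
  | some (j, i, v) => ∃ F cur, I.IsFamily F ∧ F.length = j ∧ I.IsShortestPath v (I.t i) cur ∧
      labels (cur ++ vertices F) = l

variable {d : Fin I.n → Fin I.n → ℚ≥0} {l : List ℤ} {q q' : I.PathState}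

theorem Traces.exists_isFamily {r : ℕ} (h : Traces l q) (hq : Completes r q) :
    ∃ F, I.IsFamily F ∧ F.length = r ∧ labels (vertices F) = l := by
  match q with
  | none => exact ⟨[], by simp [IsFamily], hq.symm, h.symm⟩
  | some (j, i, v) =>
    obtain ⟨rfl, rfl⟩ := hq
    obtain ⟨F, cur, hF, hj, hcur, hl⟩ := h
    exact ⟨(i, cur) :: F, isFamily_cons.2 ⟨hcur, hF⟩, by simp [hj], by rw [vertices_cons, hl]⟩

theorem Traces.step (hd : I.IsDist d) (h : Traces l q') (hstep : I.Step d q' q)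
    (hnodup : (vertex q :: l).Nodup) : Traces (vertex q :: l) q := by
  cases hstep with
  | begin hq =>
    obtain ⟨F, hF, hj, rfl⟩ := h.exists_isFamily hq
    exact ⟨F, _, hF, hj, isShortestPath_singleton _, rfl⟩
  | @extend j i v v' hadj hle =>
    obtain ⟨F, cur, hF, hj, hcur, rfl⟩ := h
    have hv : v ∉ cur := fun hv ↦ (List.nodup_cons.1 hnodup).1 <|
      List.mem_map_of_mem (List.mem_append_left _ hv)
    obtain ⟨hpath, hlength⟩ := hcur.1.cons hadj hv
    refine ⟨F, v :: cur, hF, hj, ⟨hpath, fun P hP ↦ ?_⟩, rfl⟩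
    rw [hlength, ← hd.eq hcur]
    exact hle.trans (hd.le hP)

theorem traces_of_mem_walkLabels (hd : I.IsDist d) {r : ℕ}
    (hl : l ∈ walkLabels (I.Step d) none vertex r q) (hnodup : l.Nodup) : Traces l q := by
  induction r generalizing q l with
  | zero =>
    simp only [walkLabels] at hl
    split_ifs at hl with hq
    · subst hq
      exact Multiset.mem_singleton.1 hl
    · simp at hl
  | succ r ih =>
    obtain ⟨q', hstep, l', hl', rfl⟩ := mem_walkLabels_succ.1 hl
    exact (ih hl' hnodup.of_cons).step hd hstep hnodup

theorem HasWalk.isYes {m : ℕ} (hd : I.IsDist d) (h : I.HasWalk d m) : I.IsYes := by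
  obtain ⟨q, hq, l, hl, hnodup⟩ := h
  obtain ⟨F, hF, hp, rfl⟩ := (traces_of_mem_walkLabels hd hl hnodup).exists_isFamily hq
  exact hF.isYes (nodup_labels.1 hnodup) hp

theorem IsShortestPath.exists_walk (hd : I.IsDist d) {r : ℕ} {j : Fin I.p} {i : Fin I.k}
    {v : Fin I.n} {cur : List (Fin I.n)} (hcur : I.IsShortestPath v (I.t i) cur)
    (hq : Completes j q) (hl : l ∈ walkLabels (I.Step d) none vertex r q) :
    labels cur ++ l ∈ walkLabels (I.Step d) none vertex (cur.length + r) (some (j, i, v)) := by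
  induction cur generalizing v with
  | nil => exact absurd hcur.1.1 (by simp)
  | cons u cur ih =>
    obtain rfl : u = v := by simpa using hcur.1.1
    rw [List.length_cons, Nat.succ_add, mem_walkLabels_succ]
    cases cur with
    | nil =>
      obtain rfl : u = I.t i := by simpa using hcur.1.2.1
      exact ⟨q, .begin hq, l, by simpa using hl, rfl⟩
    | cons v' cur =>
      obtain ⟨hadj, htail⟩ := hcur.tail
      refine ⟨_, .extend hadj ?_, _, ih htail, rfl⟩
      rw [hd.eq htail, hd.eq hcur, pathLength_cons_cons]

theorem IsFamily.exists_walk (hd : I.IsDist d) {F : List (Fin I.k × List (Fin I.n))}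
    (hF : I.IsFamily F) (hp : F.length ≤ I.p) : ∃ q, Completes F.length q ∧
      labels (vertices F) ∈ walkLabels (I.Step d) none vertex (vertices F).length q := by
  induction F with
  | nil => exact ⟨none, rfl, by simp [vertices, labels, walkLabels]⟩
  | cons f F ih =>
    obtain ⟨hf, hF⟩ := isFamily_cons.1 hF
    obtain ⟨q, hq, hl⟩ := ih hF (Nat.le_of_succ_le hp)
    refine ⟨some (⟨F.length, hp⟩, f.1, I.s f.1), ⟨rfl, rfl⟩, ?_⟩
    rw [vertices_cons, List.length_append, labels, List.map_append]
    exact hf.exists_walk hd hq hl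

theorem IsYes.exists_hasWalk (h : I.IsYes) (hd : I.IsDist d) :
    ∃ m ≤ I.n, m ≤ 2 * I.ell ∧ I.HasWalk d m := by
  obtain ⟨F, hF, hnodup, hp, hn, hell⟩ := h.exists_isFamily
  obtain ⟨q, hq, hl⟩ := hF.exists_walk hd hp.le
  exact ⟨_, hn, hell, q, hp ▸ hq, _, hl, nodup_labels.2 hnodup⟩

theorem IsDist.exists_forall_lt_iff (hd : I.IsDist d) : ∃ M, (∀ m < M, m ≤ I.n ∧ m ≤ 2 * I.ell) ∧
    (I.IsYes ↔ ∃ m < M, I.HasWalk d m) ∧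
    ∀ i ≤ M, i < M ↔ i ≤ I.n ∧ ¬∃ m < i, I.HasWalk d m := by
  classical
  by_cases h : I.IsYes
  · obtain ⟨m, hn, hell, hm⟩ := h.exists_hasWalk hd
    have hex : ∃ m, I.HasWalk d m := ⟨m, hm⟩
    have hfind : Nat.find hex ≤ m := Nat.find_min' hex hm
    refine ⟨Nat.find hex + 1, fun i hi ↦ by lia,
      iff_of_true h ⟨_, Nat.lt_succ_self _, Nat.find_spec hex⟩, fun i hi ↦ ?_⟩
    have hle : (¬∃ m < i, I.HasWalk d m) ↔ i ≤ Nat.find hex := by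
      simp only [Nat.le_find_iff, not_exists, not_and]
    rw [hle]
    lia
  · have no_walk (m : ℕ) : ¬ I.HasWalk d m := mt (HasWalk.isYes hd) h
    refine ⟨I.n + 1, fun m hm ↦ ⟨by lia, ?_⟩, by simp [h, no_walk], by simp [no_walk]⟩
    rw [ell, if_neg h]
    lia

end PathState

end MVDSP

theorem mul_add_fin_inj {B a a' : ℕ} {b b' : Fin B} (h : a * B + b = a' * B + b') :
    a = a' ∧ b = b' := by
  have hB : 0 < B := b.pos
  refine ⟨?_, Fin.ext ?_⟩
  · simpa [Nat.mul_add_div, Nat.div_eq_of_lt, hB, mul_comm] using congrArg (· / B) h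
  · simpa [Nat.mod_eq_of_lt] using congrArg (· % B) h

theorem mul_add_fin_lt {A B a : ℕ} (ha : a < A) (b : Fin B) : a * B + b < A * B :=
  calc a * B + b < (a + 1) * B := by rw [add_one_mul]; gcongr; exact b.2
    _ ≤ A * B := Nat.mul_le_mul_right _ ha

namespace MVDSP

variable {I : MVDSP}

section BellmanFord

/-- Every estimate in `D` of the distance between two vertices is at least the length of a path;
`⊤` means that no path is known. -/
def IsAttained (I : MVDSP) (D : Fin I.n → Fin I.n → WithTop ℚ≥0) : Prop :=
  ∀ u t, D u t ≠ ⊤ → ∃ P, I.IsPath u t P ∧ (I.pathLength P : WithTop ℚ≥0) ≤ D u t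

/-- The estimates in `D` do not exceed the lengths of the paths with at most `r` arcs. -/
def IsLowerBound (I : MVDSP) (r : ℕ) (D : Fin I.n → Fin I.n → WithTop ℚ≥0) : Prop :=
  ∀ u t P, I.IsPath u t P → P.length ≤ r + 1 → D u t ≤ I.pathLength P

open Classical in
/-- The estimates after an attempt to improve `D u t` by starting with the arc from `u` to `v`. -/
noncomputable def relax (I : MVDSP) (D : Fin I.n → Fin I.n → WithTop ℚ≥0) (u v t : Fin I.n) :
    Fin I.n → Fin I.n → WithTop ℚ≥0 := fun a b ↦
  if I.G.Adj u v ∧ a = u ∧ b = t then min (D u t) (I.w u v + D v t) else D a b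

variable {D D₀ : Fin I.n → Fin I.n → WithTop ℚ≥0} {u v t : Fin I.n}

theorem relax_le (D : Fin I.n → Fin I.n → WithTop ℚ≥0) (u v t : Fin I.n) :
    I.relax D u v t ≤ D := by
  intro a b
  unfold relax
  split_ifs with h
  · obtain ⟨-, rfl, rfl⟩ := h
    exact min_le_left _ _
  · rfl

theorem relax_of_le (hadj : I.G.Adj u v) (hle : I.w u v + D v t ≤ D u t) :
    I.relax D u v t = fun a b ↦ if a = u ∧ b = t then I.w u v + D v t else D a b := by
  ext1 a
  ext1 b
  by_cases hab : a = u ∧ b = t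
  · rw [relax, if_pos ⟨hadj, hab⟩, if_pos hab, min_eq_right hle]
  · rw [relax, if_neg (hab ·.2), if_neg hab]

theorem relax_eq_self (hle : I.G.Adj u v → D u t ≤ I.w u v + D v t) : I.relax D u v t = D := by
  ext1 a
  ext1 b
  unfold relax
  split_ifs with h
  · obtain ⟨hadj, rfl, rfl⟩ := h
    exact min_eq_left (hle hadj)
  · rfl

theorem relax_apply_le (hadj : I.G.Adj u v) : I.relax D u v t u t ≤ I.w u v + D v t := by
  simp [relax, hadj]

theorem IsAttained.relax (hD : I.IsAttained D) (u v t : Fin I.n) :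
    I.IsAttained (I.relax D u v t) := by
  intro a b hab
  unfold MVDSP.relax at hab ⊢
  split_ifs at hab ⊢ with h
  · obtain ⟨hadj, rfl, rfl⟩ := h
    rcases min_choice (D a b) (I.w a v + D v b) with hmin | hmin <;> rw [hmin] at hab ⊢
    · exact hD a b hab
    · obtain ⟨P, hP, hle⟩ := hD v b fun htop ↦ hab (by simp [htop])
      obtain ⟨P', hP', hle'⟩ := hP.exists_isPath_of_adj hadj
      refine ⟨P', hP', le_trans ?_ (add_le_add_right hle _)⟩
      exact_mod_cast hle'
  · exact hD a b hab

theorem IsLowerBound.succ {r : ℕ} (h : I.IsLowerBound r D₀) (hle : D ≤ D₀)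
    (hrelaxed : ∀ u v t, I.G.Adj u v → D u t ≤ I.w u v + D₀ v t) : I.IsLowerBound (r + 1) D := by
  intro u t P hP hlength
  obtain ⟨l, rfl⟩ := hP.exists_eq_cons
  cases l with
  | nil => exact (hle u t).trans (h u t _ hP (by simp))
  | cons v l =>
    obtain ⟨-, hadj, -, htail⟩ := isPath_cons_cons.1 hP
    rw [pathLength_cons_cons, WithTop.coe_add]
    exact (hrelaxed u v t hadj).trans
      (add_le_add_right (h v t _ htail (by simpa using hlength)) _)

theorem isAttained_self : I.IsAttained fun u t ↦ if u = t then 0 else ⊤ := by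
  intro u t hD
  obtain rfl : u = t := by_contra fun h ↦ hD (if_neg h)
  exact ⟨[u], (isShortestPath_singleton u).1, by simp [pathLength]⟩

theorem isLowerBound_zero_self : I.IsLowerBound 0 fun u t ↦ if u = t then 0 else ⊤ := by
  intro u t P hP hlength
  obtain ⟨l, rfl⟩ := hP.exists_eq_cons
  obtain rfl : l = [] := by simpa using hlength
  obtain rfl : u = t := by simpa using hP.2.1
  simp

theorem IsAttained.isDist (hD : I.IsAttained D) (hlow : I.IsLowerBound I.n D)
    {d : Fin I.n → Fin I.n → ℚ≥0} (hd : ∀ u t, D u t ≠ ⊤ → D u t = d u t) : I.IsDist d := by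
  have le {u t P} (hP : I.IsPath u t P) : D u t ≤ I.pathLength P :=
    hlow u t P hP ((hP.2.2.2.length_le_card.trans_eq (Fintype.card_fin _)).trans (Nat.le_succ _))
  have ne_top {u t P} (hP : I.IsPath u t P) : D u t ≠ ⊤ :=
    ne_top_of_le_ne_top WithTop.coe_ne_top (le hP)
  refine ⟨fun hP ↦ ?_, fun hP ↦ ?_⟩
  · exact_mod_cast (hd _ _ (ne_top hP)) ▸ le hP
  · obtain ⟨Q, hQ, hle⟩ := hD _ _ (ne_top hP)
    rw [hd _ _ (ne_top hP)] at hle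
    exact ⟨Q, hQ, by exact_mod_cast hle⟩

end BellmanFord

section Code

/-- The numbering of the states in lexicographic order, beginning with `none`. -/
def code (I : MVDSP) : I.PathState ≃ Fin (I.p * I.k * I.n + 1) :=
  (Equiv.optionCongr ((Equiv.prodAssoc ..).symm.trans
    ((finProdFinEquiv.prodCongr (.refl _)).trans finProdFinEquiv))).trans (finSuccEquiv _).symm

theorem code_none : (I.code none : ℕ) = 0 := rfl

theorem code_some (j : Fin I.p) (i : Fin I.k) (v : Fin I.n) :
    (I.code (some (j, i, v)) : ℕ) = (j * I.k + i) * I.n + v + 1 := by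
  simp only [code, Equiv.trans_apply, Equiv.optionCongr_apply, Option.map_some,
    finSuccEquiv_symm_some, Fin.val_succ, finProdFinEquiv_apply_val, Equiv.prodCongr_apply,
    Prod.map_apply, Equiv.refl_apply, Equiv.prodAssoc_symm_apply]
  ring

/-- The number of paths that have been begun. -/
def begun : I.PathState → ℕ
  | none => 0
  | some (j, _, _) => j + 1

end Code

end MVDSP

-- Notations, not definitions, so that `decide` and `simp` see numerals; the registers of the
-- instance are those fixed by `MVDSP.input`.
local notation "vN" => (0 : ℕ)
local notation "vK" => (1 : ℕ)
local notation "vP" => (2 : ℕ)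
local notation "vAnswer" => (3 : ℕ)
local notation "vQ" => (4 : ℕ)
local notation "vM" => (5 : ℕ)
local notation "vI" => (6 : ℕ)
local notation "vJ" => (7 : ℕ)
local notation "vL" => (8 : ℕ)
local notation "vR" => (9 : ℕ)
local notation "vY" => (10 : ℕ)
local notation "vX" => (11 : ℕ)
local notation "vState" => (12 : ℕ)
local notation "vZ" => (13 : ℕ)
local notation "vA" => (14 : ℕ)
local notation "vB" => (15 : ℕ)
local notation "vRestX" => (16 : ℕ)
local notation "vRestY" => (17 : ℕ)
local notation "vPos" => (18 : ℕ)
local notation "vNeg" => (19 : ℕ)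
local notation "vPosX" => (20 : ℕ)
local notation "vNegX" => (21 : ℕ)
local notation "vPosY" => (22 : ℕ)
local notation "vNegY" => (23 : ℕ)
local notation "vTmp" => (24 : ℕ)
local notation "vBase" => (25 : ℕ)
local notation "aAdj" => (0 : ℕ)
local notation "aSource" => (1 : ℕ)
local notation "aTarget" => (2 : ℕ)
local notation "aRow" => (3 : ℕ)
local notation "aReach" => (4 : ℕ)
local notation "aBegun" => (5 : ℕ)
local notation "aPair" => (6 : ℕ)
local notation "aVertex" => (7 : ℕ)
local notation "aPow" => (8 : ℕ)
local notation "aQPow" => (9 : ℕ)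
local notation "aPos" => (10 : ℕ)
local notation "aNeg" => (11 : ℕ)
local notation "qLength" => (0 : ℕ)
local notation "qDist" => (1 : ℕ)
local notation:60 c:61 " ;; " d:60 => RAM.Prog.seq c d

namespace RAM

variable {I : MVDSP} {N : ℕ} {σ τ : State} {c : Prog}

section Input

/-- The memory contains the instance `I`. -/
structure HasInput (I : MVDSP) (σ : State) : Prop where
  order : σ.var vN = I.n
  pairs : σ.var vK = I.k
  demand : σ.var vP = I.p
  adj (u v : Fin I.n) : 1 ≤ σ.arr aAdj (u * I.n + v) ↔ I.G.Adj u v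
  length {u v : Fin I.n} : I.G.Adj u v → σ.qarr qLength (u * I.n + v) = I.w u v
  source (i : Fin I.k) : σ.arr aSource i = I.s i
  target (i : Fin I.k) : σ.arr aTarget i = I.t i

theorem hasInput_input (I : MVDSP) : HasInput I I.input := by
  have index (u v : Fin I.n) : (u : ℕ) * I.n + v = (finProdFinEquiv (u, v) : Fin (I.n * I.n)) := by
    rw [finProdFinEquiv_apply_val, mul_comm, add_comm]
  refine ⟨rfl, rfl, rfl, fun u v ↦ ?_, fun {u v} hadj ↦ ?_, ?_, ?_⟩
  · simp only [index, MVDSP.input, if_true, Fin.is_lt, dite_true, Fin.eta]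
    rw [Equiv.symm_apply_apply]
    split_ifs <;> simp [*]
  · simp only [index, MVDSP.input, if_true, Fin.is_lt, dite_true, Fin.eta]
    rw [Equiv.symm_apply_apply, if_pos hadj]
  all_goals simp [MVDSP.input]

/-- The locations of the instance. -/
def inputLocs : List Loc :=
  [.var vN, .var vK, .var vP, .arr aAdj, .arr aSource, .arr aTarget, .qarr qLength]

theorem HasInput.of_frame (h : HasInput I σ) (hτ : Frame c σ τ)
    (hc : ∀ l ∈ inputLocs, c.writes l = false := by decide) : HasInput I τ where
  order := (hτ.var (hc _ (by decide))).trans h.order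
  pairs := (hτ.var (hc _ (by decide))).trans h.pairs
  demand := (hτ.var (hc _ (by decide))).trans h.demand
  adj u v := by rw [hτ.arr (hc _ (by decide)), h.adj]
  length hadj := by rw [hτ.qarr (hc _ (by decide)), h.length hadj]
  source i := by rw [hτ.arr (hc _ (by decide)), h.source]
  target i := by rw [hτ.arr (hc _ (by decide)), h.target]

end Input

section Tabulate

/-- Fill the first entries of the array `a` recursively: `e` is the value of the entry `0`, and
`f` that of the entry `vI + 1`. -/
def tabulate (a : ℕ) (e f limit : NExp) : Prog :=
  .put a (.lit 0) e ;; .forLoop vI limit (.put a (.add (.var vI) (.lit 1)) f)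

theorem exec_tabulate {a M : ℕ} {e f limit : NExp} (F : ℕ → ℕ) (hM : M ≤ N)
    (hlimit : ∀ τ, Frame (tabulate a e f limit) σ τ → limit.eval τ = M) (start : e.eval σ = F 0)
    (step : ∀ i < M, ∀ τ, Frame (tabulate a e f limit) σ τ → τ.var vI = i → τ.arr a i = F i →
      f.eval τ = F (i + 1)) :
    Exec N (tabulate a e f limit) σ fun τ ↦ ∀ i ≤ M, τ.arr a i = F i := by
  have put := (Runs.put σ a (.lit 0) e).frame.seq_left
    (d := .forLoop vI limit (.put a (.add (.var vI) (.lit 1)) f))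
  refine .seq (.put (.forLoop (fun i τ ↦ ∀ i' ≤ i, τ.arr a i' = F i') hM rfl
    (fun τ hτ ↦ hlimit τ (put.trans hτ.seq_right)) (fun _ _ _ h ↦ h) ?_
    fun i hi τ hτ hvI hInv ↦ .put fun i' hi' ↦ ?_))
  · simp [start]
  · simp only [State.setArr_arr, if_true, NExp.eval, hvI]
    obtain rfl | hne := eq_or_ne i' (i + 1)
    · simp [step i hi τ (put.trans hτ.seq_right) hvI (hInv i le_rfl)]
    · simp [hne, hInv i' (by lia)]

end Tabulate

section Distances

/-- The memory contains the instance `I` and the multiples of its number of vertices, by which the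
rows of a matrix are found without multiplications. -/
structure HasRows (I : MVDSP) (σ : State) : Prop extends HasInput I σ where
  row (u : Fin I.n) : σ.arr aRow u = u * I.n

theorem HasRows.of_frame (h : HasRows I σ) (hτ : Frame c σ τ)
    (hc : ∀ l ∈ .arr aRow :: inputLocs, c.writes l = false := by decide) : HasRows I τ where
  toHasInput := h.toHasInput.of_frame hτ fun _ hl ↦ hc _ (List.mem_cons_of_mem _ hl)
  row u := by rw [hτ.arr (hc _ (by decide)), h.row]

/-- Compute the multiples of the number of vertices. -/
def rows : Prog :=
  tabulate aRow (.lit 0) (.add (.get aRow (.var vI)) (.var vN)) (.var vN)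

theorem exec_rows (hN : I.n ≤ N) (hI : HasInput I σ) : Exec N rows σ (HasRows I) := by
  refine (exec_tabulate (· * I.n) hN (fun τ hτ ↦ by simp [(hI.of_frame hτ).order]) (by simp)
    fun i _ τ hτ hvI hrow ↦ ?_).mono fun τ hτ hrow ↦ ⟨hI.of_frame hτ, fun u ↦ hrow u u.2.le⟩
  simp [hvI, hrow, (hI.of_frame hτ).order, add_one_mul]

/-- The index of the matrix entry in the row `x` and the column `y`. -/
def matIndex (x y : ℕ) : NExp := .add (.get aRow (.var x)) (.var y)

theorem HasRows.eval_matIndex (h : HasRows I σ) {x y : ℕ} {u v : Fin I.n} (hx : σ.var x = u)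
    (hy : σ.var y = v) : (matIndex x y).eval σ = u * I.n + v := by
  simp [matIndex, hx, hy, h.row]

/-- The estimates of the distances in the arrays `aReach` and `qDist`. -/
def estimate (I : MVDSP) (σ : State) (u t : Fin I.n) : WithTop ℚ≥0 :=
  if 1 ≤ σ.arr aReach (u * I.n + t) then (σ.qarr qDist (u * I.n + t) : WithTop ℚ≥0) else ⊤

theorem estimate_setQArr_setArr (u t : Fin I.n) (w : ℚ≥0) :
    estimate I ((σ.setQArr qDist (u * I.n + t) w).setArr aReach (u * I.n + t) 1) = fun a b ↦
      if a = u ∧ b = t then (w : WithTop ℚ≥0) else estimate I σ a b := by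
  ext1 a
  ext1 b
  split_ifs with hab
  · simp [estimate, hab]
  · have hne : (a : ℕ) * I.n + b ≠ u * I.n + t := fun h ↦
      hab ⟨Fin.ext (mul_add_fin_inj h).1, (mul_add_fin_inj h).2⟩
    simp [estimate, hne]

/-- Try to improve the estimate for `vI` and `vL` by starting with the arc from `vI` to `vJ`. -/
def relaxStep : Prog :=
  let newDist : QExp := .add (.get qLength (matIndex vI vJ)) (.get qDist (matIndex vJ vL))
  .ite (.and (.and (.le (.lit 1) (.get aAdj (matIndex vI vJ)))
        (.le (.lit 1) (.get aReach (matIndex vJ vL))))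
      (.not (.and (.le (.lit 1) (.get aReach (matIndex vI vL)))
        (.qle (.get qDist (matIndex vI vL)) newDist))))
    (.qput qDist (matIndex vI vL) newDist ;; .put aReach (matIndex vI vL) (.lit 1))
    .skip

theorem exec_relaxStep (hI : HasRows I σ) {u v t : Fin I.n} (hu : σ.var vI = u)
    (hv : σ.var vJ = v) (ht : σ.var vL = t) :
    Exec N relaxStep σ fun τ ↦ estimate I τ = I.relax (estimate I σ) u v t := by
  have uv := hI.eval_matIndex hu hv
  have vt := hI.eval_matIndex hv ht
  have ut := hI.eval_matIndex hu ht
  have ut' {w} : (matIndex vI vL).eval (σ.setQArr qDist (u * I.n + t) w) = u * I.n + t := ut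
  refine .ite (fun hb ↦ .seq (.qput (.put ?_))) (fun hb ↦ .skip ?_)
  all_goals
    simp only [BExp.holds_and, BExp.holds_not, BExp.holds_le, BExp.holds_qle, NExp.eval,
      QExp.eval, uv, vt, ut, hI.adj] at hb
  · obtain ⟨⟨hadj, hreach⟩, hlonger⟩ := hb
    have shorter : I.w u v + estimate I σ v t ≤ estimate I σ u t := by
      simp only [estimate, hreach, if_true, ← WithTop.coe_add, ← hI.length hadj]
      split_ifs with h
      · exact WithTop.coe_le_coe.2 (le_of_not_ge fun hle ↦ hlonger ⟨h, hle⟩)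
      · exact le_top
    rw [MVDSP.relax_of_le hadj shorter]
    simp only [NExp.eval, QExp.eval, uv, vt, ut, ut', estimate_setQArr_setArr]
    simp [estimate, hreach, hI.length hadj]
  · refine (MVDSP.relax_eq_self fun hadj ↦ ?_).symm
    by_cases hreach : 1 ≤ σ.arr aReach (v * I.n + t)
    · obtain ⟨h, hle⟩ := not_not.1 fun h ↦ hb ⟨⟨hadj, hreach⟩, h⟩
      rw [hI.length hadj] at hle
      simp only [estimate, hreach, h, if_true]
      exact_mod_cast hle
    · simp [estimate, hreach]

/-- One round of the Bellman–Ford algorithm, for all targets at once. -/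
def relaxRound : Prog :=
  .forLoop vI (.var vN) (.forLoop vJ (.var vN) (.forLoop vL (.var vN) relaxStep))

theorem exec_relaxRound (hN : I.n ≤ N) (hI : HasRows I σ) {r : ℕ}
    (hatt : I.IsAttained (estimate I σ)) (hlow : I.IsLowerBound r (estimate I σ)) :
    Exec N relaxRound σ fun τ ↦
      I.IsAttained (estimate I τ) ∧ I.IsLowerBound (r + 1) (estimate I τ) := by
  refine (Exec.forLoop₃ (fun z τ ↦ I.IsAttained (estimate I τ) ∧ estimate I τ ≤ estimate I σ ∧
      ∀ u v t : Fin I.n, I.G.Adj u v → (u * I.n + v) * I.n + t < z →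
        estimate I τ u t ≤ I.w u v + estimate I σ v t) hN hN hN (by decide)
    (fun τ hτ ↦ ?_) (fun _ _ _ _ _ h ↦ h) ⟨hatt, le_rfl, by simp⟩
    fun u hu v hv t ht τ hτ hvI hvJ hvL ⟨hatt, hle, hrelaxed⟩ ↦ ?_).mono
      fun τ _ ⟨hatt, hle, hrelaxed⟩ ↦ ⟨hatt, hlow.succ hle fun u v t hadj ↦
        hrelaxed u v t hadj (mul_add_fin_lt (mul_add_fin_lt u.2 v) t)⟩
  · simp [(hI.of_frame hτ).order]
  lift u to Fin I.n using hu
  lift v to Fin I.n using hv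
  lift t to Fin I.n using ht
  refine (exec_relaxStep (hI.of_frame hτ) hvI hvJ hvL).mono fun υ _ hυ ↦ ?_
  rw [hυ]
  refine ⟨hatt.relax u v t, (MVDSP.relax_le _ u v t).trans hle, fun a b c hadj hlt ↦ ?_⟩
  obtain hlt | heq := (Nat.lt_succ_iff.1 hlt).lt_or_eq
  · exact (MVDSP.relax_le _ u v t a c).trans (hrelaxed a b c hadj hlt)
  · obtain ⟨hab, rfl⟩ := mul_add_fin_inj heq
    obtain ⟨hval, rfl⟩ := mul_add_fin_inj hab
    obtain rfl := Fin.ext hval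
    exact (MVDSP.relax_apply_le hadj).trans (by gcongr; exact hle b c)

/-- Compute the distances by the Bellman–Ford algorithm. -/
def distances : Prog :=
  .forLoop vI (.var vN) (.put aReach (matIndex vI vI) (.lit 1)) ;;
    .forLoop vR (.var vN) relaxRound

/-- The distances in memory. -/
def dist (I : MVDSP) (σ : State) (u t : Fin I.n) : ℚ≥0 := σ.qarr qDist (u * I.n + t)

theorem exec_reach_self (hN : I.n ≤ N) (hI : HasRows I σ) (hreach : σ.arr aReach = 0)
    (hdist : σ.qarr qDist = 0) :
    Exec N (.forLoop vI (.var vN) (.put aReach (matIndex vI vI) (.lit 1))) σ fun τ ↦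
      estimate I τ = fun u t ↦ if u = t then 0 else ⊤ := by
  refine (Exec.forLoop (fun i τ ↦ ∀ u t : Fin I.n,
      1 ≤ τ.arr aReach (u * I.n + t) ↔ u = t ∧ u < i) hN rfl
    (fun τ hτ ↦ by simp [(hI.of_frame hτ).order]) (fun _ _ _ h ↦ h) (by simp [hreach])
    fun i hi τ hτ hvI hInv ↦ .put fun u t ↦ ?_).mono fun τ hτ hInv ↦ ?_
  · lift i to Fin I.n using hi
    simp only [(hI.of_frame hτ).eval_matIndex hvI hvI, NExp.eval, State.setArr_arr, if_true]
    obtain heq | hne := eq_or_ne ((u : ℕ) * I.n + t) (i * I.n + i)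
    · obtain ⟨hu, rfl⟩ := mul_add_fin_inj heq
      simp [Fin.ext hu]
    · rw [Function.update_of_ne hne, hInv]
      refine and_congr_right fun hut ↦ ?_
      have : (u : ℕ) ≠ i := fun hui ↦ hne (by rw [← hut, hui])
      lia
  · ext1 u
    ext1 t
    simp [estimate, hInv, hτ.qarr rfl, hdist]

theorem exec_distances (hN : I.n ≤ N) (hI : HasRows I σ) (hreach : σ.arr aReach = 0)
    (hdist : σ.qarr qDist = 0) : Exec N distances σ fun τ ↦ I.IsDist (dist I τ) := by
  refine .seq ((exec_reach_self hN hI hreach hdist).mono fun τ hτ hself ↦ ?_)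
  have hIτ := hI.of_frame hτ
  refine (Exec.forLoop (fun r υ ↦ I.IsAttained (estimate I υ) ∧ I.IsLowerBound r (estimate I υ))
    hN (by decide) (fun υ hυ ↦ by simp [(hIτ.of_frame hυ).order]) (fun _ _ _ h ↦ h) ?_
    fun r _ υ hυ _ ⟨hatt, hlow⟩ ↦ exec_relaxRound hN (hIτ.of_frame hυ) hatt hlow).mono
      fun υ _ ⟨hatt, hlow⟩ ↦ hatt.isDist hlow fun u t hut ↦ ?_
  · exact hself ▸ ⟨MVDSP.isAttained_self, MVDSP.isLowerBound_zero_self⟩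
  · simp only [estimate, ne_eq, ite_eq_right_iff, WithTop.coe_ne_top, imp_false, not_not] at hut
    simp [estimate, hut, dist]

end Distances

end RAM

namespace RAM

variable {I : MVDSP} {N : ℕ} {σ τ : State} {c : Prog} {d : Fin I.n → Fin I.n → ℚ≥0}

section States

/-- The tables of the states describe the state `q`. -/
structure Describes (σ : State) (q : I.PathState) : Prop where
  begun : σ.arr aBegun (I.code q) = MVDSP.begun q
  pair {j : Fin I.p} {i : Fin I.k} {v : Fin I.n} :
    q = some (j, i, v) → σ.arr aPair (I.code q) = i
  vertex : (σ.arr aVertex (I.code q) : ℤ) = MVDSP.vertex q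

/-- The tables of the states contain the first `z` states in the order of `MVDSP.code`. -/
structure Lists (I : MVDSP) (z : ℕ) (σ : State) : Prop where
  count : σ.var vQ = z
  describes (q : I.PathState) : I.code q < z → Describes σ q

/-- Append a state to the tables. -/
def appendState (begun pair vertex : NExp) : Prog :=
  .put aBegun (.var vQ) begun ;; .put aPair (.var vQ) pair ;; .put aVertex (.var vQ) vertex ;;
    .set vQ (.add (.var vQ) (.lit 1))

theorem exec_appendState {begun pair vertex : NExp} {z : ℕ} {q : I.PathState} (hz : Lists I z σ)
    (hq : I.code q = z)
    (hbegun : ∀ τ : State, τ.var = σ.var → begun.eval τ = MVDSP.begun q)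
    (hpair : ∀ τ : State, τ.var = σ.var → ∀ j i v, q = some (j, i, v) → pair.eval τ = i)
    (hvertex : ∀ τ : State, τ.var = σ.var → (vertex.eval τ : ℤ) = MVDSP.vertex q) :
    Exec N (appendState begun pair vertex) σ (Lists I (z + 1)) := by
  refine .seq (.put (.seq (.put (.seq (.put (.set ?_))))))
  simp only [NExp.eval, State.setArr_var, hz.count]
  refine ⟨by simp, fun q' hq' ↦ ?_⟩
  obtain rfl | hne := eq_or_ne q' q
  · exact ⟨by simp [hq, hbegun], fun h ↦ by simpa [hq] using hpair _ (by rfl) _ _ _ h,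
      by simpa [hq] using hvertex _ (by rfl)⟩
  · have hcode : (I.code q' : ℕ) ≠ z := fun h ↦ hne (I.code.injective (Fin.ext (h.trans hq.symm)))
    obtain ⟨hbegun', hpair', hvertex'⟩ := hz.describes q' (by lia)
    exact ⟨by simpa [hcode], by simpa [hcode], by simpa [hcode]⟩

/-- Tabulate the states. -/
def states : Prog :=
  .set vQ (.lit 0) ;; appendState (.lit 0) (.lit 0) (.lit 0) ;;
    .forLoop vI (.var vP) (.forLoop vJ (.var vK) (.forLoop vL (.var vN)
      (appendState (.add (.var vI) (.lit 1)) (.var vJ) (.var vL))))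

theorem exec_states (hn : I.n ≤ N) (hk : I.k ≤ N) (hp : I.p ≤ N) (hI : HasInput I σ) :
    Exec N states σ (Lists I (I.p * I.k * I.n + 1)) := by
  refine .seq (.set ?_)
  refine .seq ((exec_appendState (I := I) (q := none) ⟨by simp, by simp⟩ MVDSP.code_none
    (fun _ _ ↦ rfl) (by simp) (fun _ _ ↦ rfl)).mono fun τ hτ hτ₀ ↦ ?_)
  have hIτ := (hI.of_frame (Runs.set σ vQ (.lit 0)).frame).of_frame hτ
  refine Exec.forLoop₃ (fun z ↦ Lists I (z + 1)) hp hk hn (by decide)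
    (fun υ hυ ↦ ?_) ?_ hτ₀ fun j hj i hi v hv υ _ hvI hvJ hvL hz ↦ ?_
  · simp [(hIτ.of_frame hυ).order, (hIτ.of_frame hυ).pairs, (hIτ.of_frame hυ).demand]
  · rintro z υ v r hr ⟨hcount, hdescribes⟩
    refine ⟨?_, fun q hq ↦ ⟨(hdescribes q hq).1, (hdescribes q hq).2, (hdescribes q hq).3⟩⟩
    have : vQ ≠ r := by rintro rfl; simp at hr
    simp [this, hcount]
  · refine exec_appendState (q := some (⟨j, hj⟩, ⟨i, hi⟩, ⟨v, hv⟩)) hz (MVDSP.code_some ..)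
      (fun ω hω ↦ ?_) (fun ω hω ↦ ?_) (fun ω hω ↦ ?_)
    · simp [hω, hvI, MVDSP.begun]
    · rintro _ _ _ ⟨⟩
      simp [hω, hvJ]
    · simp [hω, hvL, MVDSP.vertex]

end States

section Tables

/-- The memory contains the instance `I`, the distances `d` between its vertices, the tables of
its states, and multiples of powers of two, by which the table of the walk sums is indexed. -/
structure HasTables (I : MVDSP) (d : Fin I.n → Fin I.n → ℚ≥0) (σ : State) : Prop
    extends HasRows I σ, Lists I (I.p * I.k * I.n + 1) σ where
  dist : RAM.dist I σ = d
  pow {a : ℕ} : a ≤ 2 * I.n → σ.arr aPow a = 2 ^ a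
  qpow {a : ℕ} : a ≤ 2 * I.n → σ.arr aQPow a = (I.p * I.k * I.n + 1) * 2 ^ a

/-- The locations of the tables. -/
def tableLocs : List Loc :=
  inputLocs ++ [.arr aRow, .var vQ, .arr aBegun, .arr aPair, .arr aVertex, .qarr qDist, .arr aPow,
    .arr aQPow]

theorem Lists.of_frame {z : ℕ} (h : Lists I z σ) (hτ : Frame c σ τ)
    (hc : ∀ l ∈ [Loc.var vQ, .arr aBegun, .arr aPair, .arr aVertex], c.writes l = false :=
      by decide) : Lists I z τ where
  count := (hτ.var (hc _ (by decide))).trans h.count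
  describes q hq := {
    begun := by rw [hτ.arr (hc _ (by decide)), (h.describes q hq).begun]
    pair := by rw [hτ.arr (hc _ (by decide))]; exact (h.describes q hq).pair
    vertex := by rw [hτ.arr (hc _ (by decide)), (h.describes q hq).vertex] }

theorem HasTables.of_frame (h : HasTables I d σ) (hτ : Frame c σ τ)
    (hc : ∀ l ∈ tableLocs, c.writes l = false := by decide) : HasTables I d τ where
  toHasRows := h.toHasRows.of_frame hτ fun l hl ↦ hc l <| by
    revert l
    decide
  toLists := h.toLists.of_frame hτ fun l hl ↦ hc l <| by
    revert l
    decide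
  dist := by rw [← h.dist]; unfold RAM.dist; rw [hτ.qarr (hc _ (by decide))]
  pow ha := by rw [hτ.arr (hc _ (by decide)), h.pow ha]
  qpow ha := by rw [hτ.arr (hc _ (by decide)), h.qpow ha]

/-- Tabulate the products of `e` with the powers of two. -/
def doubles (a : ℕ) (e : NExp) : Prog :=
  tabulate a e (.add (.get a (.var vI)) (.get a (.var vI))) (.add (.var vN) (.var vN))

theorem exec_doubles {a : ℕ} {e : NExp} (hN : 2 * I.n ≤ N)
    (hI : ∀ τ, Frame (doubles a e) σ τ → HasInput I τ) :
    Exec N (doubles a e) σ fun τ ↦ ∀ i ≤ 2 * I.n, τ.arr a i = e.eval σ * 2 ^ i :=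
  exec_tabulate (e.eval σ * 2 ^ ·) hN (fun τ hτ ↦ by simp [(hI τ hτ).order, two_mul]) (by simp)
    fun i _ τ _ hvI hi ↦ by simp only [NExp.eval, hvI, hi]; ring

/-- Compute all the tables. -/
def prepare : Prog :=
  rows ;; distances ;; states ;; doubles aPow (.lit 1) ;; doubles aQPow (.var vQ)

theorem exec_prepare (hn : 2 * I.n ≤ N) (hk : I.k ≤ N) (hp : I.p ≤ N) :
    Exec N prepare I.input fun τ ↦ ∃ d, I.IsDist d ∧ HasTables I d τ := by
  have hn' : I.n ≤ N := by lia
  refine .seq ((exec_rows hn' (hasInput_input I)).mono fun σ₁ hσ₁ hI₁ ↦ ?_)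
  have hreach : σ₁.arr aReach = 0 := (hσ₁.arr rfl).trans (by ext; simp [MVDSP.input])
  have hzero : σ₁.qarr qDist = 0 := (hσ₁.qarr rfl).trans (by ext; simp [MVDSP.input])
  refine .seq ((exec_distances hn' hI₁ hreach hzero).mono fun σ₂ hσ₂ hdist ↦ ?_)
  have hI₂ := hI₁.of_frame hσ₂
  refine .seq ((exec_states hn' hk hp hI₂.toHasInput).mono fun σ₃ hσ₃ hstates ↦ ?_)
  have hI₃ := hI₂.of_frame hσ₃
  refine .seq ((exec_doubles hn fun τ hτ ↦ (hI₃.of_frame hτ).toHasInput).mono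
    fun σ₄ hσ₄ hpow ↦ ?_)
  have hI₄ := hI₃.of_frame hσ₄
  refine (exec_doubles hn fun τ hτ ↦ (hI₄.of_frame hτ).toHasInput).mono
    fun σ₅ hσ₅ hqpow ↦ ⟨dist I σ₂, hdist, ?_⟩
  have hstates₄ := hstates.of_frame hσ₄
  exact {
    toHasRows := hI₄.of_frame hσ₅
    toLists := hstates₄.of_frame hσ₅
    dist := by unfold dist; rw [hσ₅.qarr rfl, hσ₄.qarr rfl, hσ₃.qarr rfl]
    pow := fun ha ↦ by rw [hσ₅.arr rfl, hpow _ ha, NExp.eval, one_mul]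
    qpow := fun ha ↦ by rw [hqpow _ ha, NExp.eval, hstates₄.count] }

end Tables

end RAM

namespace RAM

variable {I : MVDSP} {N : ℕ} {σ τ : State} {c : Prog} {d : Fin I.n → Fin I.n → ℚ≥0}

section StepTest

/-- The test whether in the state `x` exactly `r` paths are complete and no path is incomplete. -/
def completesTest (r : NExp) (x : ℕ) : BExp :=
  .and (.eq (.get aBegun (.var x)) r)
    (.or (.le (.get aBegun (.var x)) (.lit 0))
      (.eq (.get aVertex (.var x)) (.get aSource (.get aPair (.var x)))))

/-- The test for a step from the state `vI` to the state `vState`. -/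
def stepTest : BExp :=
  let begun (x : ℕ) : NExp := .get aBegun (.var x)
  let pair (x : ℕ) : NExp := .get aPair (.var x)
  let vertex (x : ℕ) : NExp := .get aVertex (.var x)
  let target : NExp := .get aTarget (pair vState)
  let index (e f : NExp) : NExp := .add (.get aRow e) f
  .and (.le (.lit 1) (begun vState)) <| .or
    (.and (completesTest (.sub (begun vState) (.lit 1)) vI) (.eq (vertex vState) target))
    (.and (.and (.eq (begun vI) (begun vState)) (.eq (pair vI) (pair vState))) <|
      .and (.le (.lit 1) (.get aAdj (index (vertex vState) (vertex vI))))
        (.qle (.add (.get qLength (index (vertex vState) (vertex vI)))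
            (.get qDist (index (vertex vI) target)))
          (.get qDist (index (vertex vState) target))))

theorem HasTables.state_some (h : HasTables I d σ) (j : Fin I.p) (i : Fin I.k) (v : Fin I.n) :
    σ.arr aBegun (I.code (some (j, i, v))) = j + 1 ∧
      σ.arr aPair (I.code (some (j, i, v))) = i ∧
      σ.arr aVertex (I.code (some (j, i, v))) = v :=
  let ⟨hbegun, hpair, hvertex⟩ := h.describes (some (j, i, v)) (Fin.is_lt _)
  ⟨hbegun, hpair rfl, Int.ofNat_inj.1 hvertex⟩

theorem HasTables.begun_none (h : HasTables I d σ) : σ.arr aBegun (I.code none) = 0 :=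
  (h.describes none (Fin.is_lt _)).begun

theorem HasTables.holds_completesTest (h : HasTables I d σ) {r : NExp} {x : ℕ} {q : I.PathState}
    (hx : σ.var x = I.code q) :
    (completesTest r x).Holds σ ↔ MVDSP.Completes (r.eval σ) q := by
  match q with
  | none => simp [completesTest, hx, h.begun_none, MVDSP.Completes, eq_comm]
  | some (j, i, v) =>
    obtain ⟨hbegun, hpair, hvertex⟩ := h.state_some j i v
    simp [completesTest, hx, hbegun, hpair, hvertex, h.source, MVDSP.Completes, Fin.ext_iff,
      eq_comm]

theorem HasTables.holds_stepTest (h : HasTables I d σ) {q q' : I.PathState}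
    (hq' : σ.var vI = I.code q') (hq : σ.var vState = I.code q) :
    stepTest.Holds σ ↔ I.Step d q' q := by
  match q with
  | none =>
    simp only [stepTest, BExp.holds_and, BExp.holds_le, NExp.eval, hq, h.begun_none]
    exact iff_of_false (by simp) nofun
  | some (j, i, v) =>
    obtain ⟨hbegun, hpair, hvertex⟩ := h.state_some j i v
    rw [MVDSP.step_some_iff]
    simp only [stepTest, BExp.holds_and, BExp.holds_or, BExp.holds_le, BExp.holds_eq,
      BExp.holds_qle, NExp.eval, QExp.eval, h.holds_completesTest hq', hq, hq', hbegun, hpair,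
      hvertex, h.target, h.row, le_add_iff_nonneg_left, zero_le, true_and, add_tsub_cancel_right,
      Fin.val_inj]
    refine or_congr_right ?_
    match q' with
    | none => simp [h.begun_none]
    | some (j', i', v') =>
      obtain ⟨hbegun', hpair', hvertex'⟩ := h.state_some j' i' v'
      simp only [hbegun', hpair', hvertex', h.adj, h.row, Option.some.injEq, Prod.mk.injEq,
        add_left_inj, Fin.val_inj]
      have hdist (u t : Fin I.n) : σ.qarr qDist (u * I.n + t) = d u t :=
        congrFun (congrFun h.dist u) t
      constructor
      · rintro ⟨⟨rfl, rfl⟩, hadj, hle⟩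
        rw [h.length hadj, hdist, hdist] at hle
        exact ⟨v', ⟨rfl, rfl, rfl⟩, hadj, hle⟩
      · rintro ⟨_, ⟨rfl, rfl, rfl⟩, hadj, hle⟩
        rw [h.length hadj, hdist, hdist]
        exact ⟨⟨rfl, rfl⟩, hadj, hle⟩

end StepTest

end RAM

namespace RAM

variable {N : ℕ} {σ : State}

section SignedArithmetic

/-- The integer that the variables `x` and `y` represent. Words are natural numbers, so an integer
is stored as a difference. -/
def State.diff (σ : State) (x y : ℕ) : ℤ := σ.var x - σ.var y

/-- Multiply the variable `x` by the `e`-th power of `f`. -/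
def mulPow (x : ℕ) (f e : NExp) : Prog :=
  .forLoop vJ e
    (.set vTmp (.lit 0) ;; .forLoop vL f (.set vTmp (.add (.var vTmp) (.var x))) ;;
      .set x (.var vTmp))

theorem exec_mulPow {x E F : ℕ} {e f : NExp} (hx : x ∉ [vJ, vL, vTmp]) (hE : E ≤ N) (hF : F ≤ N)
    (heval : ∀ τ, Frame (mulPow x f e) σ τ → e.eval τ = E ∧ f.eval τ = F) :
    Exec N (mulPow x f e) σ fun τ ↦ τ.var x = σ.var x * F ^ E := by
  simp only [List.mem_cons, List.not_mem_nil, or_false, not_or] at hx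
  obtain ⟨hxJ, hxL, hxT⟩ := hx
  refine .forLoop (fun i τ ↦ τ.var x = σ.var x * F ^ i) hE
    (by simp [Prog.writes, Prog.forLoop, Ne.symm hxJ]) (fun τ hτ ↦ (heval τ hτ).1)
    (fun i τ v h ↦ by simp [hxJ, h]) (by simp) fun i _ τ hτ _ hi ↦ ?_
  refine .seq (.set (.seq ((Exec.forLoop
    (fun j υ ↦ υ.var vTmp = j * τ.var x ∧ υ.var x = τ.var x) hF rfl (fun υ hυ ↦ ?_)
    (fun j υ v h ↦ by simpa [hxL]) (by simp [hxT]) fun j _ υ _ _ hj ↦ .set ?_).mono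
      fun υ _ hυ ↦ .set ?_)))
  · exact (heval υ (hτ.trans (((Frame.setVar rfl).seq_left).trans
      hυ.seq_left.seq_right).forLoop)).2
  · simp [hj, hxT, add_one_mul]
  · simp [hυ, hi, pow_succ]
    ring

end SignedArithmetic

section BitLoop

/-- The round of `bitLoop` for the next position. -/
def bitRound (a r pos neg val val' : ℕ) (body : Prog) : Prog :=
  .set a (.sub (.var a) (.lit 1)) ;;
    .ite (.le (.get aPow (.var a)) (.var r))
      (.set r (.sub (.var r) (.get aPow (.var a))) ;; body ;; .set vTmp (.var pos) ;;
        .set pos (.add (.var val) (.var neg)) ;; .set neg (.add (.var val') (.var vTmp)))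
      .skip

/-- Accumulate the alternating sum over the positions of the ones in the binary expansion of `x` in
`pos` and `neg`. In the round for the position `a`, the summand is the difference of `val` and
`val'` that `body` computes. The positions are visited in descending order, so that in each round
the sum so far is subtracted from the new summand. -/
def bitLoop (x a r pos neg val val' : ℕ) (body : Prog) : Prog :=
  .set a (.var vM) ;; .set r (.var x) ;; .set pos (.lit 0) ;; .set neg (.lit 0) ;;
    .while (.le (.lit 1) (.var a)) (bitRound a r pos neg val val' body)

variable {x a r pos neg val val' : ℕ} {body : Prog}

theorem exec_bitRound {X b : ℕ} {s s' : ℤ} (vars : [a, r, pos, neg, val, val', vTmp].Nodup)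
    (hbody : ∀ y ∈ [a, r, pos, neg], body.writes (.var y) = false)
    (ha : σ.var a = b + 1) (hr : σ.var r = X % 2 ^ (b + 1)) (hpow : σ.arr aPow b = 2 ^ b)
    (hs : σ.diff pos neg = s)
    (step : b ∈ bitSet X → ∀ τ, Frame (bitRound a r pos neg val val' body) σ τ → τ.var a = b →
      Exec N body τ fun υ ↦ υ.diff val val' = s') :
    Exec N (bitRound a r pos neg val val' body) σ fun τ ↦ τ.var a = b ∧ τ.var r = X % 2 ^ b ∧
      τ.diff pos neg = if b ∈ bitSet X then s' - s else s := by
  have vars' := List.nodup_reverse.2 vars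
  simp only [List.reverse_cons, List.reverse_nil, List.nil_append, List.cons_append,
    List.nodup_cons, List.mem_cons, List.not_mem_nil, or_false, not_or] at vars vars'
  simp only [List.mem_cons, List.not_mem_nil, or_false, forall_eq_or_imp, forall_eq] at hbody
  have test : 2 ^ b ≤ σ.var r ↔ b ∈ bitSet X := by rw [mem_bitSet, hr]
  refine .seq (.set (.ite (fun hmem ↦ ?_) fun hmem ↦ .skip ?_))
  · replace hmem : b ∈ bitSet X := by simpa [vars', ha, hpow, test] using hmem
    refine .seq (.set (.seq ((step hmem _ ?_ (by simp [vars, ha])).mono fun τ hτ hval ↦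
      .seq (.set (.seq (.set (.set ⟨?_, ?_, ?_⟩)))))))
    · exact (Frame.setVar (by simp [bitRound, Prog.writes])).trans
        (.setVar (by simp [bitRound, Prog.writes]))
    · simp [vars, hτ.var hbody.1, ha]
    · simp [vars, vars', hτ.var hbody.2.1, ha, hpow, hr, mod_two_pow_of_mem_bitSet hmem]
    · rw [if_pos hmem, ← hval, ← hs]
      simp only [State.diff, State.setVar_var, NExp.eval, vars, vars', hτ.var hbody.2.2.1,
        hτ.var hbody.2.2.2, if_true, if_false, Nat.cast_add]
      ring
  · replace hmem : b ∉ bitSet X := by simpa [vars', ha, hpow, test] using hmem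
    rw [if_neg hmem, ← hs, ← mod_two_pow_of_notMem_bitSet hmem, ← hr]
    simp [ha, State.diff, vars']

theorem exec_bitLoop {m : ℕ} (g : ℕ → ℤ) (hm : m ≤ N)
    (vars : [x, a, r, pos, neg, val, val', vTmp, vM].Nodup)
    (hbody : ∀ y ∈ [x, a, r, pos, neg, vM], body.writes (.var y) = false)
    (hpow : body.writes (.arr aPow) = false) (hvM : σ.var vM = m) (hx : σ.var x < 2 ^ m)
    (pow : ∀ b < m, σ.arr aPow b = 2 ^ b)
    (step : ∀ b ∈ bitSet (σ.var x), ∀ τ, Frame (bitLoop x a r pos neg val val' body) σ τ →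
      τ.var a = b → Exec N body τ fun υ ↦ υ.diff val val' = g b) :
    Exec N (bitLoop x a r pos neg val val' body) σ fun τ ↦
      τ.diff pos neg = alternatingSum (bitSet (σ.var x)) g := by
  have start_frame (v v') : Frame (bitLoop x a r pos neg val val' body) σ
      ((((σ.setVar a v).setVar r v').setVar pos 0).setVar neg 0) := by
    refine (((Frame.setVar ?_).trans (.setVar ?_)).trans (.setVar ?_)).trans (.setVar ?_) <;>
      simp [bitLoop, Prog.writes]
  have round_frame {τ υ} (h : Frame (bitRound a r pos neg val val' body) τ υ) :
      Frame (bitLoop x a r pos neg val val' body) τ υ := h.seq_right.seq_right.seq_right.seq_right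
  have nodup : [a, r, pos, neg, val, val', vTmp].Nodup := vars.tail.sublist (by simp)
  simp only [List.nodup_cons, List.mem_cons, List.not_mem_nil, or_false, not_or] at vars
  set X := σ.var x
  refine .seq (.set (.seq (.set (.seq (.set (.seq (.set ((Exec.while (fun i τ ↦
    τ.var a = m - i ∧ τ.var r = X % 2 ^ (m - i) ∧
      τ.diff pos neg = alternatingSum {b ∈ bitSet X | m - i ≤ b} g) hm ?_ ?_ ?_).mono
        fun τ _ hτ ↦ ?_))))))))
  · rintro i hi τ - ⟨ha, -⟩
    simp [ha]
    lia
  · have none_above : {b ∈ bitSet X | m ≤ b} = ∅ :=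
      Finset.filter_eq_empty_iff.2 fun b hb ↦ (lt_of_mem_bitSet hx hb).not_ge
    simp [none_above, alternatingSum, State.diff, vars, hvM, Nat.mod_eq_of_lt hx, X]
  · rintro i hi τ hframe ⟨ha, hr, hsum⟩
    replace hframe := (start_frame _ _).trans hframe.seq_right.seq_right.seq_right.seq_right
    obtain ⟨b, hb⟩ : ∃ b, m - i = b + 1 := ⟨m - i - 1, by lia⟩
    rw [show m - (i + 1) = b by lia, alternatingSum_filter_le]
    rw [hb] at ha hr hsum
    refine exec_bitRound nodup
      (fun y hy ↦ hbody y (.tail _ (List.mem_append_left [vM] hy))) ha hr ?_ hsum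
      fun hmem υ hυ ↦ step b hmem υ (hframe.trans (round_frame hυ))
    rw [hframe.arr (by simp [bitLoop, bitRound, Prog.writes, hpow]), pow b (by lia)]
  · simpa using hτ.2.2

end BitLoop

end RAM

namespace RAM

variable {I : MVDSP} {N m : ℕ} {σ τ : State} {c : Prog} {d : Fin I.n → Fin I.n → ℚ≥0}
  {Y X : Fin (2 ^ m)} {q : I.PathState}

section WalkSumTable

/-- The index, in the arrays `aPos` and `aNeg`, of the walk sum for `X`, `Y` and `q`, where the
column sets are encoded by the binary expansions of `X` and `Y`. -/
def cellIndex (Y X : Fin (2 ^ m)) (q : I.PathState) : ℕ :=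
  (Y * 2 ^ m + X) * (I.p * I.k * I.n + 1) + I.code q

theorem cellIndex_inj {Y' X' : Fin (2 ^ m)} {q' : I.PathState}
    (h : cellIndex Y X q = cellIndex Y' X' q') : Y = Y' ∧ X = X' ∧ q = q' := by
  obtain ⟨hYX, hq⟩ := mul_add_fin_inj h
  obtain ⟨hY, hX⟩ := mul_add_fin_inj hYX
  exact ⟨Fin.ext hY, hX, I.code.injective hq⟩

/-- The integer that is represented by the `i`-th entries of the arrays `aPos` and `aNeg`. -/
def entry (σ : State) (i : ℕ) : ℤ := σ.arr aPos i - σ.arr aNeg i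

/-- The first `z` walk sums have been computed. -/
def Filled (I : MVDSP) (d : Fin I.n → Fin I.n → ℚ≥0) (m z : ℕ) (σ : State) : Prop :=
  ∀ (Y X : Fin (2 ^ m)) (q : I.PathState), cellIndex Y X q < z → entry σ (cellIndex Y X q) =
    walkSum (I.Step d) none MVDSP.vertex (bitSet X) (bitSet Y) q

theorem Filled.of_frame {z : ℕ} (h : Filled I d m z σ) (hτ : Frame c σ τ)
    (hc : ∀ l ∈ [Loc.arr aPos, .arr aNeg], c.writes l = false := by decide) :
    Filled I d m z τ := by
  intro Y X q hz
  rw [← h Y X q hz, entry, hτ.arr (hc _ (by decide)), hτ.arr (hc _ (by decide)), entry]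

/-- The first walk sums have been computed, and the next one is that for `X`, `Y` and `q`. -/
structure AtCell (I : MVDSP) (d : Fin I.n → Fin I.n → ℚ≥0) (Y X : Fin (2 ^ m)) (q : I.PathState)
    (σ : State) : Prop extends HasTables I d σ where
  size : σ.var vM = m
  rowSet : σ.var vY = Y
  columnSet : σ.var vX = X
  state : σ.var vState = I.code q
  index : σ.var vZ = cellIndex Y X q
  filled : Filled I d m (cellIndex Y X q) σ

/-- The locations that are read, but not written, for the computation of a walk sum. -/
def cellLocs : List Loc :=
  tableLocs ++ [.var vM, .var vY, .var vX, .var vState, .var vZ, .arr aPos, .arr aNeg]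

theorem AtCell.of_frame (h : AtCell I d Y X q σ) (hτ : Frame c σ τ)
    (hc : ∀ l ∈ cellLocs, c.writes l = false := by decide) : AtCell I d Y X q τ where
  toHasTables := h.toHasTables.of_frame hτ fun l hl ↦ hc l (List.mem_append_left _ hl)
  size := (hτ.var (hc _ (by decide))).trans h.size
  rowSet := (hτ.var (hc _ (by decide))).trans h.rowSet
  columnSet := (hτ.var (hc _ (by decide))).trans h.columnSet
  state := (hτ.var (hc _ (by decide))).trans h.state
  index := (hτ.var (hc _ (by decide))).trans h.index
  filled := h.filled.of_frame hτ fun l hl ↦ hc l <| by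
    revert l
    decide

theorem AtCell.entry_predecessor (h : AtCell I d Y X q σ) (hm : m ≤ I.n) {a b : ℕ}
    (ha : a ∈ bitSet X) (hb : b ∈ bitSet Y) (q' : I.PathState) :
    entry σ (σ.var vZ - (σ.var vState + (σ.arr aQPow a + σ.arr aQPow (m + b))) + I.code q') =
      walkSum (I.Step d) none MVDSP.vertex ((bitSet X).erase a) ((bitSet Y).erase b) q' := by
  obtain ⟨x, hx⟩ := Nat.exists_eq_add_of_le' (two_pow_le_of_mem_bitSet ha)
  obtain ⟨y, hy⟩ := Nat.exists_eq_add_of_le' (two_pow_le_of_mem_bitSet hb)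
  have ha_pos := Nat.two_pow_pos a
  have ham := lt_of_mem_bitSet X.2 ha
  have hbm := lt_of_mem_bitSet Y.2 hb
  have hxm : x < 2 ^ m := by lia
  have hym : y < 2 ^ m := by lia
  have hindex : σ.var vZ - (σ.var vState + (σ.arr aQPow a + σ.arr aQPow (m + b))) + I.code q' =
      cellIndex ⟨y, hym⟩ ⟨x, hxm⟩ q' := by
    rw [h.index, h.state, h.qpow (by lia), h.qpow (by lia), cellIndex, cellIndex, hx, hy]
    exact congrArg (· + _) (Nat.sub_eq_of_eq_add (by ring))
  have hbefore : cellIndex ⟨y, hym⟩ ⟨x, hxm⟩ q' < cellIndex Y X q := by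
    have hsets : y * 2 ^ m + x < Y * 2 ^ m + X :=
      add_lt_add_of_le_of_lt (Nat.mul_le_mul_right _ (by lia)) (by lia)
    exact (mul_add_fin_lt hsets (I.code q')).trans_le (Nat.le_add_right _ _)
  rw [hindex, h.filled _ _ _ hbefore, ← bitSet_sub ha, ← bitSet_sub hb, hx, hy,
    Nat.add_sub_cancel, Nat.add_sub_cancel]

/-- Sum the walk sums over the states with a step to the current state, for the column sets without
the positions `vA` and `vB`. -/
def predecessorSum : Prog :=
  .set vBase (.sub (.var vZ) (.add (.var vState)
      (.add (.get aQPow (.var vA)) (.get aQPow (.add (.var vM) (.var vB)))))) ;;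
    .set vPos (.lit 0) ;; .set vNeg (.lit 0) ;;
    .forLoop vI (.var vQ) (.ite stepTest
      (.set vPos (.add (.var vPos) (.get aPos (.add (.var vBase) (.var vI)))) ;;
        .set vNeg (.add (.var vNeg) (.get aNeg (.add (.var vBase) (.var vI)))))
      .skip)

theorem sum_code_lt_succ (g : I.PathState → ℤ) (q : I.PathState) :
    ∑ q' with (I.code q' : ℕ) < I.code q + 1, g q' =
      ∑ q' with (I.code q' : ℕ) < I.code q, g q' + g q := by
  have hinsert : ({q' | (I.code q' : ℕ) < I.code q + 1} : Finset I.PathState) =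
      insert q ({q' | (I.code q' : ℕ) < I.code q} : Finset I.PathState) := by
    ext q'
    simp [le_iff_eq_or_lt, Fin.val_inj]
  rw [hinsert, Finset.sum_insert (by simp), add_comm]

theorem exec_predecessorSum (hQ : I.p * I.k * I.n + 1 ≤ N) (hm : m ≤ I.n)
    (h : AtCell I d Y X q σ) (ha : σ.var vA ∈ bitSet X) (hb : σ.var vB ∈ bitSet Y) :
    Exec N predecessorSum σ fun τ ↦ τ.diff vPos vNeg = ∑ q' with I.Step d q' q,
      walkSum (I.Step d) none MVDSP.vertex ((bitSet X).erase (σ.var vA))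
        ((bitSet Y).erase (σ.var vB)) q' := by
  have start_frame (v : ℕ) : Frame predecessorSum σ
      (((σ.setVar vBase v).setVar vPos 0).setVar vNeg 0) :=
    ((Frame.setVar rfl).trans (.setVar rfl)).trans (.setVar rfl)
  have predecessor := h.entry_predecessor hm ha hb
  set W := walkSum (I.Step d) none MVDSP.vertex ((bitSet X).erase (σ.var vA))
    ((bitSet Y).erase (σ.var vB))
  refine .seq (.set (.seq (.set (.seq (.set ((Exec.forLoop (fun i τ ↦ τ.diff vPos vNeg =
    ∑ q' with (I.code q' : ℕ) < i, if I.Step d q' q then W q' else 0) hQ rfl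
    (fun τ hτ ↦ ?_) (fun i τ v hτ ↦ ?_) ?_ fun i hi τ hτ hvI hsum ↦ ?_).mono fun τ _ hτ ↦ ?_))))))
  · exact (h.of_frame ((start_frame _).trans hτ.seq_right.seq_right.seq_right)).count
  · simpa [State.diff] using hτ
  · simp [State.diff]
  · have hbase := hτ.var (x := vBase) rfl
    replace hτ := (start_frame _).trans hτ.seq_right.seq_right.seq_right
    have hcell := h.of_frame hτ
    obtain ⟨q', rfl⟩ : ∃ q', (I.code q' : ℕ) = i := ⟨I.code.symm ⟨i, hi⟩, by simp⟩
    have hstep := hcell.holds_stepTest hvI hcell.state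
    rw [sum_code_lt_succ, ← hsum]
    refine .ite (fun htest ↦ .seq (.set (.set ?_))) fun htest ↦ .skip ?_
    · rw [if_pos (hstep.1 htest), ← predecessor q', entry, ← hτ.arr (a := aPos) rfl,
        ← hτ.arr (a := aNeg) rfl]
      simp [State.diff, hbase, hvI, h.size]
      ring
    · rw [if_neg (mt hstep.2 htest), add_zero]
  · simpa only [Fin.is_lt, Finset.filter_true, Finset.sum_filter] using hτ

end WalkSumTable

end RAM

namespace RAM

variable {I : MVDSP} {N m : ℕ} {σ : State} {d : Fin I.n → Fin I.n → ℚ≥0} {Y X : Fin (2 ^ m)}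
  {q : I.PathState}

section WalkSumCell

/-- The summand of `walkSum_eq` for the positions `a` and `b`. -/
noncomputable def summandValue (d : Fin I.n → Fin I.n → ℚ≥0) (Y X : Fin (2 ^ m))
    (q : I.PathState) (b a : ℕ) : ℤ :=
  MVDSP.vertex q ^ (a + b) * ∑ q' with I.Step d q' q,
    walkSum (I.Step d) none MVDSP.vertex ((bitSet X).erase a) ((bitSet Y).erase b) q'

/-- Compute the difference `summandValue` for the positions `vA` and `vB` in `vPos` and `vNeg`. -/
def summand : Prog :=
  predecessorSum ;; mulPow vPos (.get aVertex (.var vState)) (.add (.var vA) (.var vB)) ;;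
    mulPow vNeg (.get aVertex (.var vState)) (.add (.var vA) (.var vB))

theorem HasTables.vertex_le (h : HasTables I d σ) (q : I.PathState) :
    σ.arr aVertex (I.code q) ≤ I.n := by
  have hvertex := (h.describes q (Fin.is_lt _)).vertex
  match q with
  | none => simp [Nat.cast_eq_zero.1 hvertex]
  | some (_, _, v) => exact (Nat.cast_injective hvertex).trans_le v.2.le

theorem exec_summand (hN : 2 * I.n ≤ N) (hQ : I.p * I.k * I.n + 1 ≤ N) (hm : m ≤ I.n)
    (h : AtCell I d Y X q σ) (ha : σ.var vA ∈ bitSet X) (hb : σ.var vB ∈ bitSet Y) :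
    Exec N summand σ fun τ ↦
      τ.diff vPos vNeg = summandValue d Y X q (σ.var vB) (σ.var vA) := by
  have ham := lt_of_mem_bitSet X.2 ha
  have hbm := lt_of_mem_bitSet Y.2 hb
  have hE : σ.var vA + σ.var vB ≤ N := by lia
  have hF : σ.arr aVertex (I.code q) ≤ N := (h.vertex_le q).trans (by lia)
  have heval (τ : State) (hτ : Frame summand σ τ) :
      (NExp.add (.var vA) (.var vB)).eval τ = σ.var vA + σ.var vB ∧
        (NExp.get aVertex (.var vState)).eval τ = σ.arr aVertex (I.code q) := by
    simp [(h.of_frame hτ).state, hτ.var (x := vA) rfl, hτ.var (x := vB) rfl,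
      hτ.arr (a := aVertex) rfl]
  refine .seq ((exec_predecessorSum hQ hm h ha hb).mono fun τ₁ hτ₁ hsum ↦ ?_)
  refine .seq ((exec_mulPow (by decide) hE hF fun υ hυ ↦ ?_).mono fun τ₂ hτ₂ hpos ↦ ?_)
  · exact heval υ (hτ₁.seq_left.trans hυ.seq_left.seq_right)
  refine (exec_mulPow (by decide) hE hF fun υ hυ ↦ ?_).mono fun τ₃ hτ₃ hneg ↦ ?_
  · exact heval υ (hτ₁.seq_left.trans (hτ₂.seq_left.trans hυ.seq_right).seq_right)
  · rw [summandValue, ← hsum, State.diff, State.diff, hneg, hτ₃.var rfl, hpos, hτ₂.var rfl,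
      ← (h.describes q (Fin.is_lt _)).vertex]
    push_cast
    ring

/-- Compute the inner alternating sum of `walkSum_eq`. -/
def columnLoop : Prog := bitLoop vX vA vRestX vPosX vNegX vPos vNeg summand

theorem exec_columnLoop (hN : 2 * I.n ≤ N) (hQ : I.p * I.k * I.n + 1 ≤ N) (hm : m ≤ I.n)
    (h : AtCell I d Y X q σ) (hb : σ.var vB ∈ bitSet Y) :
    Exec N columnLoop σ fun τ ↦ τ.diff vPosX vNegX =
      alternatingSum (bitSet X) (summandValue d Y X q (σ.var vB)) := by
  rw [← h.columnSet]
  refine exec_bitLoop _ (by lia) (by decide) (by decide) rfl h.size (h.columnSet ▸ X.2)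
    (fun a ha ↦ h.pow (by lia)) fun a ha τ hτ hvA ↦ ?_
  have hvB : τ.var vB = σ.var vB := hτ.var rfl
  rw [← hvA, ← hvB]
  exact exec_summand hN hQ hm (h.of_frame hτ) (by rwa [hvA, ← h.columnSet]) (hvB ▸ hb)

/-- Compute the outer alternating sum of `walkSum_eq`. -/
def rowLoop : Prog := bitLoop vY vB vRestY vPosY vNegY vPosX vNegX columnLoop

theorem exec_rowLoop (hN : 2 * I.n ≤ N) (hQ : I.p * I.k * I.n + 1 ≤ N) (hm : m ≤ I.n)
    (h : AtCell I d Y X q σ) :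
    Exec N rowLoop σ fun τ ↦ τ.diff vPosY vNegY =
      alternatingSum (bitSet Y) fun b ↦ alternatingSum (bitSet X) (summandValue d Y X q b) := by
  rw [← h.rowSet]
  refine exec_bitLoop _ (by lia) (by decide) (by decide) rfl h.size (h.rowSet ▸ Y.2)
    (fun b hb ↦ h.pow (by lia)) fun b hb τ hτ hvB ↦ ?_
  rw [← hvB]
  exact exec_columnLoop hN hQ hm (h.of_frame hτ) (by rwa [hvB, ← h.rowSet])

/-- Append the difference of `vPosY` and `vNegY` to the table of the walk sums. -/
def store : Prog :=
  .put aPos (.var vZ) (.var vPosY) ;; .put aNeg (.var vZ) (.var vNegY) ;;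
    .set vZ (.add (.var vZ) (.lit 1))

theorem exec_store (h : AtCell I d Y X q σ) (hsum : σ.diff vPosY vNegY =
      walkSum (I.Step d) none MVDSP.vertex (bitSet X) (bitSet Y) q) :
    Exec N store σ fun τ ↦
      τ.var vZ = cellIndex Y X q + 1 ∧ Filled I d m (cellIndex Y X q + 1) τ := by
  refine .seq (.put (.seq (.put (.set ⟨by simp [h.index], fun Y' X' q' hlt ↦ ?_⟩))))
  by_cases heq : cellIndex Y' X' q' = cellIndex Y X q
  · obtain ⟨rfl, rfl, rfl⟩ := cellIndex_inj heq
    simpa [entry, h.index, State.diff] using hsum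
  · rw [← h.filled Y' X' q' (by lia)]
    simp [entry, h.index, heq]

/-- Compute the next walk sum. -/
def cell : Prog :=
  rowLoop ;;
    .ite (.and (.le (.var vX) (.lit 0))
        (.and (.le (.var vY) (.lit 0)) (.le (.var vState) (.lit 0))))
      (.set vPosY (.add (.var vPosY) (.lit 1))) .skip ;;
    store

theorem exec_cell (hN : 2 * I.n ≤ N) (hQ : I.p * I.k * I.n + 1 ≤ N) (hm : m ≤ I.n)
    (h : AtCell I d Y X q σ) :
    Exec N cell σ fun τ ↦
      τ.var vZ = cellIndex Y X q + 1 ∧ Filled I d m (cellIndex Y X q + 1) τ := by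
  refine .seq ((exec_rowLoop hN hQ hm h).mono fun τ hτ hsum ↦ .seq ?_)
  have hcell := h.of_frame hτ
  unfold summandValue at hsum
  have htest : τ.var vX ≤ 0 ∧ τ.var vY ≤ 0 ∧ τ.var vState ≤ 0 ↔
      bitSet X = ∅ ∧ bitSet Y = ∅ ∧ q = none := by
    rw [hcell.columnSet, hcell.rowSet, hcell.state, bitSet_eq_empty_iff, bitSet_eq_empty_iff,
      ← I.code.injective.eq_iff, Fin.ext_iff, MVDSP.code_none]
    simp only [Nat.le_zero]
  refine .ite (fun hholds ↦ .set (exec_store (hcell.of_frame (Runs.set ..).frame) ?_))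
    fun hholds ↦ .skip (exec_store hcell ?_)
  · rw [walkSum_eq, if_pos (htest.1 hholds), ← hsum]
    simp [State.diff]
    ring
  · rw [walkSum_eq, if_neg (mt htest.2 hholds), zero_add, hsum]

end WalkSumCell

end RAM

namespace RAM

variable {I : MVDSP} {N m : ℕ} {σ : State} {d : Fin I.n → Fin I.n → ℚ≥0}

section Search

/-- Compute all walk sums for column sets with elements below `vM`. -/
def fill : Prog :=
  .set vZ (.lit 0) ;; .forLoop vY (.get aPow (.var vM)) (.forLoop vX (.get aPow (.var vM))
    (.forLoop vState (.var vQ) cell))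

theorem exec_fill (hN : 2 * I.n ≤ N) (hQ : I.p * I.k * I.n + 1 ≤ N) (hpow : 2 ^ m ≤ N)
    (hm : m ≤ I.n) (h : HasTables I d σ) (hvM : σ.var vM = m) :
    Exec N fill σ (Filled I d m (2 ^ m * 2 ^ m * (I.p * I.k * I.n + 1))) := by
  refine .seq (.set ((Exec.forLoop₃ (fun z τ ↦ τ.var vZ = z ∧ Filled I d m z τ) hpow hpow hQ
    (by decide) (fun τ hτ ↦ ?_) ?_ ?_ fun i hi j hj l hl τ hτ hvY hvX hvState hz ↦ ?_).mono
      fun τ _ hτ ↦ hτ.2))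
  · replace hτ : Frame fill σ τ := (Frame.setVar rfl).trans hτ.seq_right
    have hvMτ : τ.var vM = m := (hτ.var rfl).trans hvM
    simp [hvMτ, (h.of_frame hτ).pow (a := m) (by lia), (h.of_frame hτ).count]
  · rintro z τ v r hr ⟨hvZ, hfilled⟩
    have : vZ ≠ r := by rintro rfl; simp at hr
    exact ⟨by simp [this, hvZ], hfilled⟩
  · exact ⟨by simp, fun _ _ _ h ↦ absurd h (Nat.not_lt_zero _)⟩
  · replace hτ : Frame fill σ τ := (Frame.setVar rfl).trans hτ.seq_right
    have hindex : cellIndex ⟨i, hi⟩ ⟨j, hj⟩ (I.code.symm ⟨l, hl⟩) =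
        (i * 2 ^ m + j) * (I.p * I.k * I.n + 1) + l := by simp [cellIndex]
    rw [← hindex] at hz ⊢
    exact exec_cell hN hQ hm {
      toHasTables := h.of_frame hτ
      size := (hτ.var rfl).trans hvM
      rowSet := hvY
      columnSet := hvX
      state := by simpa using hvState
      index := hz.1
      filled := hz.2 }

/-- The variable `vAnswer` tells whether `p` holds. -/
def Answers (p : Prop) (σ : State) : Prop := (p → σ.var vAnswer = 1) ∧ (¬p → σ.var vAnswer = 0)

/-- The test whether the walk sum for the full column sets shows that a walk with `vM` steps as in
`MVDSP.HasWalk` ends in the state `vState`. -/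
def acceptTest : BExp :=
  let index : NExp := .add (.var vBase) (.var vState)
  .and (completesTest (.var vP) vState) (.not (.eq (.get aPos index) (.get aNeg index)))

theorem Answers.eq_zero_iff {p : Prop} (h : Answers p σ) : σ.var vAnswer = 0 ↔ ¬p := by
  refine ⟨fun h0 hp ↦ ?_, h.2⟩
  simp [h.1 hp] at h0

theorem Filled.entry_last (h : Filled I d m (2 ^ m * 2 ^ m * (I.p * I.k * I.n + 1)) σ)
    (q : I.PathState) :
    entry σ ((I.p * I.k * I.n + 1) * 2 ^ (m + m) - (I.p * I.k * I.n + 1) + I.code q) =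
      walkSum (I.Step d) none MVDSP.vertex (Finset.range m) (Finset.range m) q := by
  have hpos := Nat.two_pow_pos m
  have hlast : (2 ^ m - 1) * 2 ^ m + (2 ^ m - 1) + 1 = 2 ^ (m + m) := by
    obtain ⟨x, hx⟩ := Nat.exists_eq_add_of_le' hpos
    rw [pow_add, hx, Nat.add_sub_cancel]
    ring
  let top : Fin (2 ^ m) := ⟨2 ^ m - 1, Nat.pred_lt hpos.ne'⟩
  have hindex : (I.p * I.k * I.n + 1) * 2 ^ (m + m) - (I.p * I.k * I.n + 1) + I.code q =
      cellIndex top top q := by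
    rw [cellIndex, ← hlast, mul_add_one, Nat.add_sub_cancel, mul_comm]
  have hlt : cellIndex top top q < 2 ^ m * 2 ^ m * (I.p * I.k * I.n + 1) :=
    mul_add_fin_lt (by rw [← pow_add, ← hlast]; exact Nat.lt_succ_self _) (I.code q)
  rw [hindex, h _ _ _ hlt, bitSet_two_pow_sub_one]

theorem HasTables.holds_acceptTest (h : HasTables I d σ) {q : I.PathState}
    (hq : σ.var vState = I.code q)
    (hbase : σ.var vBase = (I.p * I.k * I.n + 1) * 2 ^ (m + m) - (I.p * I.k * I.n + 1))
    (hfilled : Filled I d m (2 ^ m * 2 ^ m * (I.p * I.k * I.n + 1)) σ) :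
    acceptTest.Holds σ ↔ MVDSP.Completes I.p q ∧
      walkSum (I.Step d) none MVDSP.vertex (Finset.range m) (Finset.range m) q ≠ 0 := by
  rw [← hfilled.entry_last q, entry, sub_ne_zero, Nat.cast_injective.ne_iff]
  simp only [acceptTest, BExp.holds_and, BExp.holds_not, BExp.holds_eq, NExp.eval,
    h.holds_completesTest hq, h.demand, hbase, hq, ne_eq]

/-- Determine whether there is a walk with `vM` steps as in `MVDSP.HasWalk`. -/
def check : Prog :=
  .set vBase (.sub (.get aQPow (.add (.var vM) (.var vM))) (.var vQ)) ;;
    .forLoop vState (.var vQ) (.ite acceptTest (.set vAnswer (.lit 1)) .skip)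

theorem exists_code_lt_succ {P : I.PathState → Prop} (q : I.PathState) :
    (∃ q', (I.code q' : ℕ) < I.code q + 1 ∧ P q') ↔
      (∃ q', (I.code q' : ℕ) < I.code q ∧ P q') ∨ P q := by
  simp only [Nat.lt_succ_iff_lt_or_eq, Fin.val_inj, EmbeddingLike.apply_eq_iff_eq, or_and_right,
    exists_or, exists_eq_left]

theorem exec_check (hQ : I.p * I.k * I.n + 1 ≤ N) (hm : m ≤ I.n) (h : HasTables I d σ)
    (hvM : σ.var vM = m) (hfilled : Filled I d m (2 ^ m * 2 ^ m * (I.p * I.k * I.n + 1)) σ)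
    (hvAnswer : σ.var vAnswer = 0) : Exec N check σ (Answers (I.HasWalk d m)) := by
  have start_frame (v : ℕ) : Frame check σ (σ.setVar vBase v) := .setVar rfl
  let EndsWalk (q : I.PathState) : Prop := MVDSP.Completes I.p q ∧
    walkSum (I.Step d) none MVDSP.vertex (Finset.range m) (Finset.range m) q ≠ 0
  have hasWalk_iff : I.HasWalk d m ↔ ∃ q, (I.code q : ℕ) < I.p * I.k * I.n + 1 ∧ EndsWalk q :=
    exists_congr fun q ↦ by simp [EndsWalk, walkSum_range_ne_zero_iff, -Order.lt_add_one_iff]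
  rw [hasWalk_iff]
  refine .seq (.set (.forLoop (fun i ↦ Answers (∃ q, (I.code q : ℕ) < i ∧ EndsWalk q)) hQ rfl
    (fun τ hτ ↦ ?_) (fun _ _ _ ↦ id) ?_ fun i hi τ hτ hvState hanswer ↦ ?_))
  · exact (h.of_frame ((start_frame _).trans hτ.seq_right)).count
  · simp [Answers, hvAnswer]
  · have hbase := hτ.var (x := vBase) rfl
    replace hτ := (start_frame _).trans hτ.seq_right
    have htables := h.of_frame hτ
    obtain ⟨q, rfl⟩ : ∃ q, (I.code q : ℕ) = i := ⟨I.code.symm ⟨i, hi⟩, by simp⟩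
    have test : acceptTest.Holds τ ↔ EndsWalk q := by
      refine htables.holds_acceptTest hvState (hbase.trans ?_) (hfilled.of_frame hτ)
      simp [hvM, h.qpow (a := m + m) (by lia), h.count]
    rw [exists_code_lt_succ]
    refine .ite (fun hq ↦ .set ⟨fun _ ↦ by simp, fun hno ↦ absurd (.inr (test.1 hq)) hno⟩)
      fun hq ↦ .skip ?_
    rwa [or_iff_left (mt test.2 hq)]

/-- Determine whether there is a walk with `vM` steps as in `MVDSP.HasWalk`, and increase `vM`. -/
def round : Prog := fill ;; check ;; .set vM (.add (.var vM) (.lit 1))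

theorem exec_round (hN : 2 * I.n ≤ N) (hQ : I.p * I.k * I.n + 1 ≤ N) (hpow : 2 ^ m ≤ N)
    (hm : m ≤ I.n) (h : HasTables I d σ) (hvM : σ.var vM = m) (hvAnswer : σ.var vAnswer = 0) :
    Exec N round σ fun τ ↦ τ.var vM = m + 1 ∧ Answers (I.HasWalk d m) τ := by
  refine .seq ((exec_fill hN hQ hpow hm h hvM).mono fun τ hτ hfilled ↦ ?_)
  have hvMτ : τ.var vM = m := (hτ.var rfl).trans hvM
  refine .seq ((exec_check hQ hm (h.of_frame hτ) hvMτ hfilled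
    ((hτ.var rfl).trans hvAnswer)).mono fun υ hυ hanswer ↦ .set ⟨?_, hanswer⟩)
  simp [hυ.var (x := vM) rfl, hvMτ]

/-- Search for walks as in `MVDSP.HasWalk` in order of their numbers of steps. -/
def search : Prog :=
  .while (.and (.le (.var vM) (.var vN)) (.le (.var vAnswer) (.lit 0))) round

theorem exec_search (hN : 2 * I.n ≤ N) (hQ : I.p * I.k * I.n + 1 ≤ N)
    (hpow : 2 ^ (2 * I.ell) ≤ N) (hd : I.IsDist d) (h : HasTables I d σ) (hvM : σ.var vM = 0)
    (hvAnswer : σ.var vAnswer = 0) : Exec N search σ (Answers I.IsYes) := by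
  obtain ⟨M, hM, hyes, hlt⟩ := hd.exists_forall_lt_iff
  rw [hyes]
  refine (Exec.while (fun i τ ↦ τ.var vM = i ∧ Answers (∃ m < i, I.HasWalk d m) τ) (M := M) ?_
    (fun i hi τ hτ ⟨hvMτ, hanswer⟩ ↦ ?_) ⟨hvM, by simp [Answers, hvAnswer]⟩
    fun i hi τ hτ ⟨hvMτ, hanswer⟩ ↦ ?_).mono fun τ _ hτ ↦ hτ.2
  · obtain _ | M := M
    · exact Nat.zero_le N
    · have := (hM M (Nat.lt_succ_self M)).1
      lia
  · rw [hlt i hi]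
    simp [hvMτ, hanswer.eq_zero_iff, (h.of_frame hτ).order]
  · obtain ⟨him, hell⟩ := hM i hi
    have none_before := ((hlt i hi.le).1 hi).2
    refine (exec_round hN hQ ((Nat.pow_le_pow_right Nat.two_pos hell).trans hpow) him
      (h.of_frame hτ) hvMτ (hanswer.2 none_before)).mono fun υ _ ⟨hvMυ, hanswer⟩ ↦ ⟨hvMυ, ?_⟩
    rwa [Nat.exists_lt_succ_right, or_iff_right none_before]

end Search

end RAM

namespace RAM

section Decide

/-- The decision procedure. Its first test is always passed by yes-instances; it bounds the loops
that depend on `p`. -/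
def program : Prog :=
  .ite (.le (.var vP) (.var vN)) (prepare ;; search) .skip ;; .set 0 (.var vAnswer)

theorem exec_program {I : MVDSP} {N : ℕ} (hN : 2 ^ (2 * I.ell) * (I.n + I.k + 1) ^ 3 ≤ N) :
    Exec N program I.input fun τ ↦ (I.IsYes → τ.var 0 = 1) ∧ (¬I.IsYes → τ.var 0 = 0) := by
  have hpow_pos : 1 ≤ 2 ^ (2 * I.ell) := Nat.one_le_two_pow
  have hcube_pos : 1 ≤ (I.n + I.k + 1) ^ 3 := Nat.one_le_pow _ _ (Nat.succ_pos _)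
  have hpow : 2 ^ (2 * I.ell) ≤ N := (Nat.le_mul_of_pos_right _ hcube_pos).trans hN
  have hcube : (I.n + I.k + 1) ^ 3 ≤ N := (Nat.le_mul_of_pos_left _ hpow_pos).trans hN
  have answer_zero : I.input.var vAnswer = 0 := rfl
  suffices Exec N (.ite (.le (.var vP) (.var vN)) (prepare ;; search) .skip) I.input
      (Answers I.IsYes) from .seq (this.mono fun τ _ hτ ↦ .set hτ)
  refine .ite (fun hp ↦ ?_) fun hp ↦ .skip ⟨fun h ↦ absurd h.demand_le hp, fun _ ↦ answer_zero⟩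
  replace hp : I.p ≤ I.n := hp
  have hsum : 2 * I.n + I.k + (I.n * I.k * I.n + 1) ≤ N :=
    hcube.trans' (by ring_nf; lia)
  have hQ : I.p * I.k * I.n + 1 ≤ N :=
    calc I.p * I.k * I.n + 1 ≤ I.n * I.k * I.n + 1 := by gcongr
      _ ≤ N := (Nat.le_add_left _ _).trans hsum
  refine .seq ((exec_prepare (by lia) (by lia) (by lia)).mono fun τ hτ ⟨d, hd, h⟩ ↦ ?_)
  exact exec_search (by lia) hQ hpow hd h (hτ.var rfl) ((hτ.var rfl).trans answer_zero)

end Decide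

end RAM

theorem MVDSP.decidedBy_program (I : MVDSP) :
    I.DecidedBy RAM.program (RAM.program.bound (2 ^ (2 * I.ell) * (I.n + I.k + 1) ^ 3)) :=
  RAM.exec_program le_rfl

theorem MVDSP.DecidedBy.mono {I : MVDSP} {c : RAM.Prog} {B B' : ℕ} (h : I.DecidedBy c B)
    (hB : B ≤ B') : I.DecidedBy c B' :=
  let ⟨T, τ, hrun, hT, hτ⟩ := h
  ⟨T, τ, hrun, hT.trans hB, hτ⟩

theorem RAM.Prog.exists_bound_exp_mul_cube_le (c : RAM.Prog) :
    ∃ C, ∀ ℓ s r : ℕ, 1 ≤ s → s ≤ r ^ 2 →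
      c.bound (2 ^ (2 * ℓ) * s ^ 3) ≤ C * 2 ^ (C * ℓ) * r ^ C := by
  obtain ⟨D, hD⟩ := c.exists_bound_le
  refine ⟨D * 2 ^ D + 6 * D, fun ℓ s r hs hsr ↦ ?_⟩
  have hr : 1 ≤ r := Nat.one_le_iff_ne_zero.2 (by rintro rfl; lia)
  have hpos : 1 ≤ 2 ^ (2 * ℓ) * s ^ 3 := Nat.mul_pos (by positivity) (by positivity)
  calc c.bound (2 ^ (2 * ℓ) * s ^ 3)
      ≤ D * (2 ^ (2 * ℓ) * s ^ 3 + 1) ^ D := hD _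
    _ ≤ D * (2 * (2 ^ (2 * ℓ) * s ^ 3)) ^ D := by gcongr; lia
    _ ≤ D * (2 * (2 ^ (2 * ℓ) * (r ^ 2) ^ 3)) ^ D := by gcongr
    _ = D * 2 ^ D * 2 ^ (2 * D * ℓ) * r ^ (6 * D) := by ring
    _ ≤ (D * 2 ^ D + 6 * D) * 2 ^ ((D * 2 ^ D + 6 * D) * ℓ) * r ^ (D * 2 ^ D + 6 * D) := by
      gcongr <;> lia

/-- Maximum Vertex-Disjoint Shortest Paths on weighted directed graphs is decided by one
deterministic program in `2 ^ O(ℓ) * poly(n)` steps. If the list of terminal pairs has repetitions,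
its length `k`, which then is not bounded in terms of `n`, counts towards the input size. -/
theorem theorem4 :
    ∃ (c : RAM.Prog) (C : ℕ), ∀ I : MVDSP,
      I.DecidedBy c (C * 2 ^ (C * I.ell) * (I.n + I.k + 1) ^ C) ∧
      (Function.Injective (fun i => (I.s i, I.t i)) →
        I.DecidedBy c (C * 2 ^ (C * I.ell) * (I.n + 1) ^ C)) := by
  obtain ⟨C, hC⟩ := RAM.program.exists_bound_exp_mul_cube_le
  refine ⟨RAM.program, C, fun I ↦ ⟨?_, fun hinj ↦ ?_⟩⟩
  · exact I.decidedBy_program.mono (hC _ _ _ (Nat.succ_pos _) (Nat.le_self_pow two_ne_zero _))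
  · have hk : I.k ≤ I.n * I.n := by simpa using Fintype.card_le_of_injective _ hinj
    exact I.decidedBy_program.mono (hC _ _ _ (Nat.succ_pos _) (by nlinarith))
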